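/- Let $[\alpha,\beta]\subset\,]\alpha_0,\beta_0[$ with $\alpha<\beta$, let $K,G,L\in C^\infty(]\alpha_0,\beta_0[)$ be positive on $]\alpha_0,\beta_0[$, and let $h,H\in[0,\infty]$. Consider the eigenvalue problem $$\frac{d}{dx}\Big(K\frac{dV}{dx}\Big)+(rG-L)V=0\ \text{ in }\ ]\alpha,\beta[,\qquad \Big(K\frac{dV}{dx}-hV\Big)(\alpha)=0,\qquad \Big(K\frac{dV}{dx}+HV\Big)(\beta)=0,$$ with spectral parameter $r\in\mathbb R$, where the boundary condition at $\alpha$ (resp. $\beta$) means $V(\alpha)=0$ (resp. $V(\beta)=0$) if $h=\infty$ (resp. $H=\infty$). Let $\rho_1<\rho_2<\cdots$ be its eigenvalues in increasing order and, for each $p$, let $V_p$ be an eigenfunction for $\rho_p$. Let $1\le m\le n$, let $A_m,\dots,A_n$ be real constants with $A_m^2+\cdots+A_n^2\neq0$, and let $Y=\sum_{p=m}^nA_pV_p$. Then $Y$ is smooth on $[\alpha,\beta]$, it has finitely many zeros $\xi_1<\dots<\xi_q$ in $]\alpha,\beta[$, and it vanishes to infinite order at no point of $[\alpha,\beta]$.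 For $\xi\in[\alpha,\beta]$ let $m(Y,\xi)=\min\{p\ge0 : Y^{(p)}(\xi)\neq0\}$ (one-sided derivatives at the endpoints). Put $\overline m(Y,\alpha)=\frac12m(Y,\alpha)$ if $h<\infty$ and $\overline m(Y,\alpha)=0$ if $h=\infty$; define $\overline m(Y,\beta)$ likewise with $H$ in place of $h$. Let $$N_v(Y)=\sum_{j=1}^q\tfrac12\big[1-(-1)^{m(Y,\xi_j)}\big],\qquad N_m(Y)=\sum_{j=1}^q m(Y,\xi_j),\qquad \overline N_m(Y)=N_m(Y)+\overline m(Y,\alpha)+\overline m(Y,\beta),$$ so that $N_v(Y)$ is the number of sign changes of $Y$ in $]\alpha,\beta[$. Then $$N_v(Y)\le N_m(Y)\le\overline N_m(Y),\qquad m-1\le N_v(Y),\qquad \overline N_m(Y)\le n-1 .$$ In particular, the number $q$ of distinct zeros of $Y$ in $]\alpha,\beta[$ satisfies $m-1\le q\le n-1$. -/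

import Mathlib

open scoped ContDiff

noncomputable section

namespace SturmLiouville

/-- Standing assumptions on the coefficients: `[α, β] ⊂ ]α₀, β₀[`, and `K`, `G`, `L` are
smooth and positive on `]α₀, β₀[`. -/
def Admissible (α₀ α β β₀ : ℝ) (K G L : ℝ → ℝ) : Prop :=
  α₀ < α ∧ α < β ∧ β < β₀ ∧
  ContDiffOn ℝ ∞ K (Set.Ioo α₀ β₀) ∧ ContDiffOn ℝ ∞ G (Set.Ioo α₀ β₀) ∧
  ContDiffOn ℝ ∞ L (Set.Ioo α₀ β₀) ∧
  ∀ x ∈ Set.Ioo α₀ β₀, 0 < K x ∧ 0 < G x ∧ 0 < L x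

/-- The boundary condition `(K V' - h V)(α) = 0`, read as `V(α) = 0` when `h = ∞`.
The derivative at `α` is the one-sided derivative within `[α, β]`. -/
def LeftBC (α β : ℝ) (K : ℝ → ℝ) (h : ENNReal) (V : ℝ → ℝ) : Prop :=
  (h = ⊤ → V α = 0) ∧
  (h ≠ ⊤ → K α * derivWithin V (Set.Icc α β) α - h.toReal * V α = 0)

/-- The boundary condition `(K V' + H V)(β) = 0`, read as `V(β) = 0` when `H = ∞`. -/
def RightBC (α β : ℝ) (K : ℝ → ℝ) (H : ENNReal) (V : ℝ → ℝ) : Prop :=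
  (H = ⊤ → V β = 0) ∧
  (H ≠ ⊤ → K β * derivWithin V (Set.Icc α β) β + H.toReal * V β = 0)

/-- `V` is an eigenfunction on `[α, β]` for the spectral parameter `r`: a nontrivial `C²`
function on `[α, β]` with `(K V')' + (r G - L) V = 0` on `]α, β[` and the two boundary
conditions. Values of `V` outside `[α, β]` play no role. -/
def IsEigenfunction (α β : ℝ) (K G L : ℝ → ℝ) (h H : ENNReal) (r : ℝ) (V : ℝ → ℝ) : Prop :=
  ContDiffOn ℝ 2 V (Set.Icc α β) ∧
  (∃ x ∈ Set.Icc α β, V x ≠ 0) ∧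
  (∀ x ∈ Set.Ioo α β,
    deriv (fun t => K t * deriv V t) x + (r * G x - L x) * V x = 0) ∧
  LeftBC α β K h V ∧ RightBC α β K H V

/-- The set of eigenvalues. -/
def eigenvalues (α β : ℝ) (K G L : ℝ → ℝ) (h H : ENNReal) : Set ℝ :=
  {r | ∃ V : ℝ → ℝ, IsEigenfunction α β K G L h H r V}

/-- `r` is the `p`-th eigenvalue in increasing order, counted from `p = 1`: it is an
eigenvalue, and exactly `p` eigenvalues are at most `r`. -/
def IsNthEigenvalue (α β : ℝ) (K G L : ℝ → ℝ) (h H : ENNReal) (p : ℕ) (r : ℝ) : Prop :=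
  r ∈ eigenvalues α β K G L h H ∧
  {s ∈ eigenvalues α β K G L h H | s ≤ r}.encard = p

/-- `V` is a `p`-th eigenfunction (an eigenfunction for the `p`-th eigenvalue). -/
def IsNthEigenfunction (α β : ℝ) (K G L : ℝ → ℝ) (h H : ENNReal) (p : ℕ) (V : ℝ → ℝ) : Prop :=
  ∃ r : ℝ, IsNthEigenvalue α β K G L h H p r ∧ IsEigenfunction α β K G L h H r V

/-- `U` vanishes to finite order at `ξ`, as a function on `[α, β]`. -/
def FiniteOrderAt (α β : ℝ) (U : ℝ → ℝ) (ξ : ℝ) : Prop :=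
  ∃ p : ℕ, iteratedDerivWithin p U (Set.Icc α β) ξ ≠ 0

/-- The multiplicity `m(U, ξ)`, the least `p` with `U⁽ᵖ⁾(ξ) ≠ 0`; derivatives are those within
`[α, β]`, so ordinary in the interior and one-sided at the endpoints. It is `0` if `U ξ ≠ 0`,
and it is meaningful only under `FiniteOrderAt`. -/
def zeroMultiplicity (α β : ℝ) (U : ℝ → ℝ) (ξ : ℝ) : ℕ :=
  sInf {p : ℕ | iteratedDerivWithin p U (Set.Icc α β) ξ ≠ 0}

/-- The reduced multiplicity of an endpoint `e` whose boundary constant is `c`. -/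
def reducedMultiplicity (α β : ℝ) (c : ENNReal) (U : ℝ → ℝ) (e : ℝ) : ℚ :=
  open Classical in if c = ⊤ then 0 else (zeroMultiplicity α β U e : ℚ) / 2

/-- The zeros of `U` in `]α, β[`. -/
def interiorZeros (α β : ℝ) (U : ℝ → ℝ) : Set ℝ := {x ∈ Set.Ioo α β | U x = 0}

/-- `N_m(U, ]α, β[)`, the number of interior zeros counted with multiplicities. -/
def Nm (α β : ℝ) (U : ℝ → ℝ) : ℚ :=
  ∑ᶠ ξ ∈ interiorZeros α β U, (zeroMultiplicity α β U ξ : ℚ)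

/-- The number of zeros in `[α, β]`: interior zeros with multiplicities, plus the reduced
multiplicities of `α` and `β`. -/
def NmBar (α β : ℝ) (h H : ENNReal) (U : ℝ → ℝ) : ℚ :=
  Nm α β U + reducedMultiplicity α β h U α + reducedMultiplicity α β H U β

/-- `N_v(U, ]α, β[)`, the number of sign changes, i.e. of interior zeros of odd
multiplicity. -/
def Nv (α β : ℝ) (U : ℝ → ℝ) : ℚ :=
  ∑ᶠ ξ ∈ interiorZeros α β U, (1 / 2 : ℚ) * (1 - (-1) ^ zeroMultiplicity α β U ξ)

end SturmLiouville

end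

/-! Put `T Y = (L Y - (K Y')') / G`, so that `T V_p = ρ_p V_p`, and let `U > 0` be the ground state,
with eigenvalue `r₀`. Following Sturm and Liouville, compare `Y` with `Z = (T - r₀) Y`. Dividing by
`U` factors the operator: `K U² (Y / U)'` is the Wronskian `K (Y' U - Y U')`, whose derivative is
`-G U Z`. Each of the two uses of Rolle's theorem loses one zero, but the Wronskian vanishes at both
endpoints by the boundary conditions, which restores two. So `Z` has at least as many zeros as `Y`
(`IsShift.NmBar_le`) and at least as many sign changes (`IsShift.alternates`).

On combinations, `T - r₀` multiplies the coefficient of `V_p` by `ρ_p - r₀`. Normalised forward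
iterates of `Y` converge in `C¹` to the top term `A_N V_N`, and a function close to it that obeys
the boundary conditions has no more zeros than `V_N` (`IsMode.exists_NmBar_le`, `NmBar_comb_le`):
this is the upper bound. Backward iterates converge to the lowest term `A_M V_M`, whose sign changes
are carried forward to `Y` (`alternates_comb`): this is the lower bound. For `m = 1` it is trivial;
for `m ≥ 2` every `ρ_p` exceeds `r₀`, so the backward iteration makes sense.

The count for a single eigenfunction comes from the Prüfer angle (`exists_angle_of_isNthEigenvalue`,
`exists_mode_of_isNthEigenfunction`). Finiteness of all orders is `eq_zero_of_flat`: successive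
shifts remove the modes one at a time and preserve flatness. -/

open Set Filter Topology

namespace SturmLiouville

/-! ### Order of vanishing of smooth functions of one real variable -/

/-- `f` vanishes at `x` together with its derivatives of order less than `k`. -/
def VanishesTo (k : ℕ) (f : ℝ → ℝ) (x : ℝ) : Prop := ∀ p < k, iteratedDeriv p f x = 0

/-- The least order of a derivative of `f` which does not vanish at `x`. -/
noncomputable def vanishingOrder (f : ℝ → ℝ) (x : ℝ) : ℕ := sInf {p : ℕ | iteratedDeriv p f x ≠ 0}

theorem contDiff_deriv {f : ℝ → ℝ} (hf : ContDiff ℝ ∞ f) : ContDiff ℝ ∞ (deriv f) :=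
  (contDiff_infty_iff_deriv.1 hf).2

theorem vanishesTo_zero (f : ℝ → ℝ) (x : ℝ) : VanishesTo 0 f x := fun p hp => by omega

theorem vanishesTo_succ {k : ℕ} {f : ℝ → ℝ} {x : ℝ} :
    VanishesTo (k + 1) f x ↔ f x = 0 ∧ VanishesTo k (deriv f) x := by
  constructor
  · intro hf
    refine ⟨by simpa using hf 0 (by omega), fun p hp => ?_⟩
    have := hf (p + 1) (by omega)
    rwa [iteratedDeriv_succ'] at this
  · rintro ⟨h0, h1⟩ p hp
    cases p with
    | zero => simpa using h0
    | succ p => rw [iteratedDeriv_succ']; exact h1 p (by omega)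

theorem VanishesTo.mono {k l : ℕ} {f : ℝ → ℝ} {x : ℝ} (hf : VanishesTo k f x) (hl : l ≤ k) :
    VanishesTo l f x := fun p hp => hf p (hp.trans_le hl)

theorem VanishesTo.congr {k : ℕ} {f g : ℝ → ℝ} {x : ℝ} (hf : VanishesTo k f x)
    (hfg : f =ᶠ[𝓝 x] g) : VanishesTo k g x := fun p hp => by
  rw [← hfg.iteratedDeriv_eq p]; exact hf p hp

theorem VanishesTo.add {k : ℕ} {f g : ℝ → ℝ} {x : ℝ} (hf : VanishesTo k f x)
    (hg : VanishesTo k g x) (hfs : ContDiff ℝ ∞ f) (hgs : ContDiff ℝ ∞ g) :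
    VanishesTo k (fun t => f t + g t) x := by
  induction k generalizing f g with
  | zero => exact vanishesTo_zero _ _
  | succ k ih =>
    rw [vanishesTo_succ] at *
    refine ⟨by rw [hf.1, hg.1, add_zero], ?_⟩
    have : deriv (fun t => f t + g t) = fun t => deriv f t + deriv g t := by
      ext t
      exact deriv_fun_add ((hfs.differentiable (by simp)) t) ((hgs.differentiable (by simp)) t)
    rw [this]
    exact ih hf.2 hg.2 (contDiff_deriv hfs) (contDiff_deriv hgs)

theorem VanishesTo.mul_left {k : ℕ} {f : ℝ → ℝ} {x : ℝ} (hf : VanishesTo k f x)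
    {u : ℝ → ℝ} (hu : ContDiff ℝ ∞ u) (hfs : ContDiff ℝ ∞ f) :
    VanishesTo k (fun t => u t * f t) x := by
  induction k generalizing f u with
  | zero => exact vanishesTo_zero _ _
  | succ k ih =>
    have hlow := hf.mono k.le_succ
    rw [vanishesTo_succ] at *
    refine ⟨by rw [hf.1, mul_zero], ?_⟩
    have : deriv (fun t => u t * f t) = fun t => deriv u t * f t + u t * deriv f t := by
      ext t
      exact deriv_fun_mul ((hu.differentiable (by simp)) t) ((hfs.differentiable (by simp)) t)
    rw [this]
    exact (ih hlow (contDiff_deriv hu) hfs).add (ih hf.2 hu (contDiff_deriv hfs))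
      ((contDiff_deriv hu).mul hfs) (hu.mul (contDiff_deriv hfs))

/-- Induction through `u f' = (u f)' - u' f`: `f` already vanishes to the lower order, hence so does
`u' f`. -/
theorem VanishesTo.of_mul_left {k : ℕ} {u f : ℝ → ℝ} {x : ℝ}
    (huf : VanishesTo k (fun t => u t * f t) x) (hx : u x ≠ 0)
    (hu : ContDiff ℝ ∞ u) (hf : ContDiff ℝ ∞ f) : VanishesTo k f x := by
  induction k generalizing f with
  | zero => exact vanishesTo_zero _ _
  | succ k ih =>
    have h1 := ih (huf.mono k.le_succ) hf
    rw [vanishesTo_succ] at *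
    refine ⟨by simpa [hx] using huf.1, ih ?_ (contDiff_deriv hf)⟩
    have h2 : deriv (fun t => u t * f t) = fun t => deriv u t * f t + u t * deriv f t := by
      ext t
      exact deriv_fun_mul ((hu.differentiable (by simp)) t) ((hf.differentiable (by simp)) t)
    rw [h2] at huf
    have hneg : ContDiff ℝ ∞ fun t => -deriv u t := (contDiff_deriv hu).neg
    have h3 := huf.2.add (h1.mul_left hneg hf)
      (((contDiff_deriv hu).mul hf).add (hu.mul (contDiff_deriv hf))) (hneg.mul hf)
    convert h3 using 2
    ring

theorem VanishesTo.deriv {k : ℕ} {f : ℝ → ℝ} {x : ℝ} (hf : VanishesTo k f x) :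
    VanishesTo (k - 1) (deriv f) x := by
  cases k with
  | zero => exact vanishesTo_zero _ _
  | succ k => exact (vanishesTo_succ.1 hf).2

theorem vanishesTo_one {f : ℝ → ℝ} {x : ℝ} : VanishesTo 1 f x ↔ f x = 0 := by
  rw [vanishesTo_succ]; simp [vanishesTo_zero]

theorem vanishesTo_vanishingOrder (f : ℝ → ℝ) (x : ℝ) : VanishesTo (vanishingOrder f x) f x :=
  fun p hp => by
    by_contra hne
    exact absurd (Nat.sInf_le (s := {p : ℕ | iteratedDeriv p f x ≠ 0}) hne) (not_le.2 hp)

theorem VanishesTo.le_vanishingOrder {k : ℕ} {f : ℝ → ℝ} {x : ℝ} (hf : VanishesTo k f x)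
    (hfin : ∃ p, iteratedDeriv p f x ≠ 0) : k ≤ vanishingOrder f x := by
  by_contra hlt
  exact Nat.sInf_mem (s := {p : ℕ | iteratedDeriv p f x ≠ 0}) hfin (hf _ (not_le.1 hlt))

/-- Near a zero of order `k`, a smooth function has the sign of the leading Taylor term. -/
theorem eventually_sign_of_vanishesTo {k : ℕ} {f : ℝ → ℝ} {x : ℝ} (hf : ContDiff ℝ ∞ f)
    (hv : VanishesTo k f x) (hk : iteratedDeriv k f x ≠ 0) :
    (∀ᶠ t in 𝓝[>] x, 0 < iteratedDeriv k f x * f t) ∧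
    (∀ᶠ t in 𝓝[<] x, 0 < (-1) ^ k * iteratedDeriv k f x * f t) := by
  induction k generalizing f with
  | zero =>
    have h0 : ∀ᶠ t in 𝓝 x, 0 < f x * f t := by
      have : ContinuousAt (fun t => f x * f t) x := (continuous_const.mul hf.continuous).continuousAt
      exact this.eventually_const_lt (by simpa using mul_self_pos.2 hk)
    simp only [iteratedDeriv_zero, pow_zero, one_mul]
    exact ⟨h0.filter_mono nhdsWithin_le_nhds, h0.filter_mono nhdsWithin_le_nhds⟩
  | succ k ih =>
    have hd := hf.differentiable (by simp)
    obtain ⟨h0, h1⟩ := vanishesTo_succ.1 hv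
    rw [iteratedDeriv_succ'] at hk ⊢
    set c := iteratedDeriv k (deriv f) x
    obtain ⟨hr, hl⟩ := ih (contDiff_deriv hf) h1 hk
    constructor
    · obtain ⟨b, hb, hr⟩ := (mem_nhdsGT_iff_exists_Ioo_subset).1 hr
      refine (mem_nhdsGT_iff_exists_Ioo_subset).2 ⟨b, hb, fun t ht => ?_⟩
      -- The mean value `f t = f' s * (t - x)` transfers the sign of `f'`; on the left, `t - x < 0`
      -- accounts for the extra factor `-1`.
      obtain ⟨s, hs, hs'⟩ := exists_deriv_eq_slope f ht.1 hd.continuous.continuousOn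
        (hd.differentiableOn)
      have h2 : 0 < c * deriv f s := hr ⟨hs.1, hs.2.trans ht.2⟩
      rw [hs', h0, sub_zero, ← mul_div_assoc] at h2
      exact (div_pos_iff_of_pos_right (sub_pos.2 ht.1)).1 h2
    · obtain ⟨b, hb, hl⟩ := (mem_nhdsLT_iff_exists_Ioo_subset).1 hl
      refine (mem_nhdsLT_iff_exists_Ioo_subset).2 ⟨b, hb, fun t ht => ?_⟩
      obtain ⟨s, hs, hs'⟩ := exists_deriv_eq_slope f ht.2 hd.continuous.continuousOn
        (hd.differentiableOn)
      have h2 : 0 < (-1) ^ k * c * deriv f s := hl ⟨ht.1.trans hs.1, hs.2⟩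
      rw [hs', h0, zero_sub, ← mul_div_assoc] at h2
      have h3 := (div_pos_iff_of_pos_right (sub_pos.2 ht.2)).1 h2
      show 0 < (-1) ^ (k + 1) * c * f t
      rw [pow_succ]
      linarith

theorem eventually_ne_zero_of_finite_order {f : ℝ → ℝ} {x : ℝ} (hf : ContDiff ℝ ∞ f)
    (hfin : ∃ p, iteratedDeriv p f x ≠ 0) : ∀ᶠ t in 𝓝[≠] x, f t ≠ 0 := by
  obtain ⟨hr, hl⟩ := eventually_sign_of_vanishesTo hf (vanishesTo_vanishingOrder f x)
    (Nat.sInf_mem (s := {p : ℕ | iteratedDeriv p f x ≠ 0}) hfin)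
  rw [← nhdsLT_sup_nhdsGT, eventually_sup]
  exact ⟨hl.mono fun t ht h0 => by simp [h0] at ht, hr.mono fun t ht h0 => by simp [h0] at ht⟩

theorem finite_zeros_of_finite_order {f : ℝ → ℝ} {a b : ℝ} (hf : ContDiff ℝ ∞ f)
    (hfin : ∀ x ∈ Icc a b, ∃ p, iteratedDeriv p f x ≠ 0) : {x ∈ Icc a b | f x = 0}.Finite := by
  by_contra hinf
  obtain ⟨x, hx, hacc⟩ := Set.Infinite.exists_accPt_of_subset_isCompact hinf
    isCompact_Icc (fun y hy => hy.1)
  rw [accPt_iff_frequently_nhdsNE] at hacc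
  exact hacc ((eventually_ne_zero_of_finite_order hf (hfin x hx)).mono fun t ht h => ht h.2)

/-- The zero is the supremum of the set where `ε * f > 0`. Just to its right `ε * f ≤ 0`, while
positive values accumulate from the left, so the leading Taylor term changes sign. -/
theorem exists_odd_order_of_sign_change {f : ℝ → ℝ} {a b ε : ℝ} (hab : a < b)
    (hf : ContDiff ℝ ∞ f) (hfin : ∀ x ∈ Ioo a b, ∃ p, iteratedDeriv p f x ≠ 0)
    (ha : 0 < ε * f a) (hb : ε * f b < 0) :
    ∃ z ∈ Ioo a b, f z = 0 ∧ Odd (vanishingOrder f z) := by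
  have hcont : Continuous fun t => ε * f t := continuous_const.mul hf.continuous
  set s := {x | x ∈ Icc a b ∧ 0 < ε * f x}
  have hsn : s.Nonempty := ⟨a, ⟨le_rfl, hab.le⟩, ha⟩
  have hlub : IsLUB s (sSup s) := isLUB_csSup hsn ⟨b, fun x hx => hx.1.2⟩
  set z := sSup s
  have haz : a ≤ z := hlub.1 ⟨⟨le_rfl, hab.le⟩, ha⟩
  have hzb : z ≤ b := hlub.2 fun x hx => hx.1.2
  have hfreq := hlub.frequently_mem hsn
  have hz1 : 0 ≤ ε * f z := by
    by_contra hc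
    have h1 : ∀ᶠ t in 𝓝[≤] z, ε * f t < 0 :=
      (hcont.continuousAt.eventually_lt_const (not_le.1 hc)).filter_mono nhdsWithin_le_nhds
    obtain ⟨t, ht, ht'⟩ := (hfreq.and_eventually h1).exists
    exact lt_asymm ht.2 ht'
  have hzb' : z < b := lt_of_le_of_ne hzb (fun h => by rw [h] at hz1; linarith)
  have hright : ∀ t ∈ Ioo z b, ε * f t ≤ 0 := fun t ht => by
    by_contra hc
    exact absurd (hlub.1 ⟨⟨haz.trans ht.1.le, ht.2.le⟩, not_le.1 hc⟩) (not_le.2 ht.1)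
  have hz0 : ε * f z = 0 := by
    refine le_antisymm ?_ hz1
    by_contra hc
    have h1 : ∀ᶠ t in 𝓝[>] z, 0 < ε * f t := (hcont.continuousAt.eventually_const_lt
      (not_le.1 hc)).filter_mono nhdsWithin_le_nhds
    obtain ⟨t, ht, ht'⟩ := (h1.and (Ioo_mem_nhdsGT hzb')).exists
    exact absurd (hright t ht') (not_le.2 ht)
  have hε : ε ≠ 0 := fun h => by simp [h] at ha
  have haz' : a < z := lt_of_le_of_ne haz (fun h => by rw [← h] at hz0; linarith)
  refine ⟨z, ⟨haz', hzb'⟩, by simpa [hε] using hz0, ?_⟩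
  have hne := Nat.sInf_mem (s := {p : ℕ | iteratedDeriv p f z ≠ 0}) (hfin z ⟨haz', hzb'⟩)
  obtain ⟨hr, hl⟩ := eventually_sign_of_vanishesTo hf (vanishesTo_vanishingOrder f z) hne
  obtain ⟨t, ht, ht'⟩ := (hr.and (Ioo_mem_nhdsGT hzb')).exists
  have hl' : ∀ᶠ t in 𝓝[≤] z, t ≠ z →
      0 < (-1) ^ vanishingOrder f z * iteratedDeriv (vanishingOrder f z) f z * f t := by
    rw [eventually_nhdsWithin_iff] at hl ⊢
    filter_upwards [hl] with t h1 h2 h3 using h1 (lt_of_le_of_ne h2 h3)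
  obtain ⟨u, hu, hu'⟩ := (hfreq.and_eventually hl').exists
  have hu'' := hu' (fun h => by have := hu.2; rw [h] at this; linarith)
  by_contra hodd
  rw [(Nat.not_odd_iff_even.1 hodd).neg_one_pow, one_mul] at hu''
  have h1 := hright t ht'
  have h2 : 0 < ε * f u := hu.2
  set c := iteratedDeriv (vanishingOrder f z) f z
  -- For an even order `c * f` is positive at both `u` and `t`, whereas `ε * f` is positive at `u`
  -- and nonpositive at `t`.
  have h3 : 0 < (ε * f u) * (c * f u) * (c * f t) ^ 2 := by positivity
  have h4 : (ε * f u) * (c * f u) * (c * f t) ^ 2 = (c * f u) ^ 2 * ((ε * f t) * (c * f t)) := by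
    ring
  have h5 : (ε * f t) * (c * f t) ≤ 0 := mul_nonpos_of_nonpos_of_nonneg h1 ht.le
  nlinarith [sq_nonneg (c * f u)]

/-! ### The Prüfer angle -/

/-- Coefficients which are smooth and positive on the whole line. -/
structure SmoothCoeffs (K G L : ℝ → ℝ) : Prop where
  contDiff_K : ContDiff ℝ ∞ K
  contDiff_G : ContDiff ℝ ∞ G
  contDiff_L : ContDiff ℝ ∞ L
  K_pos : ∀ x, 0 < K x
  G_pos : ∀ x, 0 < G x
  L_pos : ∀ x, 0 < L x

/-- The right-hand side `cos² θ / K + (r G - L) sin² θ` of the Prüfer equation. -/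
noncomputable def pruferField (K G L : ℝ → ℝ) (r x θ : ℝ) : ℝ :=
  1 / K x + (r * G x - L x - 1 / K x) * Real.sin θ ^ 2

/-- `θ` solves the Prüfer equation with parameter `r` on `[α, β]`. -/
structure IsPruferAngle (α β : ℝ) (K G L : ℝ → ℝ) (r : ℝ) (θ : ℝ → ℝ) : Prop where
  continuous : Continuous θ
  hasDerivAt : ∀ x ∈ Icc α β, HasDerivAt θ (pruferField K G L r x (θ x)) x

theorem sin_sq_sub_sin_sq (a b : ℝ) :
    Real.sin a ^ 2 - Real.sin b ^ 2 = Real.sin (a + b) * Real.sin (a - b) := by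
  rw [Real.sin_add, Real.sin_sub]
  have h1 := Real.sin_sq_add_cos_sq a
  have h2 := Real.sin_sq_add_cos_sq b
  linear_combination Real.sin b ^ 2 * h1 - Real.sin a ^ 2 * h2

theorem abs_sin_sq_sub_sin_sq_le (a b : ℝ) : |Real.sin a ^ 2 - Real.sin b ^ 2| ≤ |a - b| := by
  rw [sin_sq_sub_sin_sq, abs_mul]
  calc |Real.sin (a + b)| * |Real.sin (a - b)| ≤ 1 * |a - b| :=
        mul_le_mul (Real.abs_sin_le_one _) Real.abs_sin_le_abs (abs_nonneg _) zero_le_one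
    _ = |a - b| := one_mul _

/-- With `sin x` a continuous multiple of `x`, the Prüfer equation becomes linear in the deviation
from a reference angle, and integrating factors apply. -/
theorem sinc_mul_self (x : ℝ) : Real.sinc x * x = Real.sin x := by
  by_cases hx : x = 0
  · simp [hx]
  · rw [Real.sinc_of_ne_zero hx, div_mul_cancel₀ _ hx]

theorem exists_integratingFactor {c : ℝ → ℝ} (hc : Continuous c) :
    ∃ E : ℝ → ℝ, (∀ x, 0 < E x) ∧ ∀ x, HasDerivAt E (-(c x) * E x) x := by
  refine ⟨fun x => Real.exp (-∫ t in (0 : ℝ)..x, c t), fun x => Real.exp_pos _, fun x => ?_⟩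
  have := ((hc.integral_hasStrictDerivAt 0 x).hasDerivAt.neg).exp
  rw [mul_comm] at this
  exact this

/-- The comparison principle for first order linear differential equations. -/
theorem exists_monotoneOn_mul_of_linear {c d φ : ℝ → ℝ} {a b : ℝ} (hc : Continuous c)
    (hφ : ∀ x ∈ Icc a b, HasDerivAt φ (c x * φ x + d x) x) (hd : ∀ x ∈ Icc a b, 0 ≤ d x) :
    ∃ E : ℝ → ℝ, (∀ x, 0 < E x) ∧ (∀ x ∈ Icc a b, HasDerivAt (fun t => E t * φ t) (E x * d x) x) ∧
      MonotoneOn (fun t => E t * φ t) (Icc a b) := by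
  obtain ⟨E, hE, hE'⟩ := exists_integratingFactor hc
  have hder : ∀ x ∈ Icc a b, HasDerivAt (fun t => E t * φ t) (E x * d x) x := fun x hx => by
    refine ((hE' x).mul (hφ x hx)).congr_deriv ?_
    ring
  refine ⟨E, hE, hder, monotoneOn_of_deriv_nonneg (convex_Icc a b)
    (fun x hx => (hder x hx).continuousAt.continuousWithinAt)
    (fun x hx => (hder x (interior_subset hx)).differentiableAt.differentiableWithinAt)
    (fun x hx => ?_)⟩
  rw [(hder x (interior_subset hx)).deriv]
  exact mul_nonneg (hE x).le (hd x (interior_subset hx))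

theorem pos_of_linear {c d φ : ℝ → ℝ} {a b : ℝ} (hab : a < b) (hc : Continuous c)
    (hφ : ∀ x ∈ Icc a b, HasDerivAt φ (c x * φ x + d x) x) (hd : ∀ x ∈ Icc a b, 0 < d x)
    (ha : 0 ≤ φ a) : 0 < φ b := by
  obtain ⟨E, hE, hder, -⟩ := exists_monotoneOn_mul_of_linear hc hφ fun x hx => (hd x hx).le
  have hmono : StrictMonoOn (fun t => E t * φ t) (Icc a b) :=
    strictMonoOn_of_deriv_pos (convex_Icc a b)
      (fun x hx => (hder x hx).continuousAt.continuousWithinAt) fun x hx => by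
        rw [(hder x (interior_subset hx)).deriv]
        exact mul_pos (hE x) (hd x (interior_subset hx))
  have h1 : E a * φ a < E b * φ b := hmono ⟨le_rfl, hab.le⟩ ⟨hab.le, le_rfl⟩ hab
  exact (mul_pos_iff_of_pos_left (hE b)).1 ((mul_nonneg (hE a).le ha).trans_lt h1)

section

variable {α β : ℝ} {K G L : ℝ → ℝ} (hC : SmoothCoeffs K G L)

include hC

theorem SmoothCoeffs.continuous_inv_K : Continuous fun x => 1 / K x :=
  continuous_const.div hC.contDiff_K.continuous fun x => (hC.K_pos x).ne'

theorem SmoothCoeffs.continuous_slope (r : ℝ) :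
    Continuous fun x => r * G x - L x - 1 / K x :=
  ((continuous_const.mul hC.contDiff_G.continuous).sub hC.contDiff_L.continuous).sub
    hC.continuous_inv_K

/-- The field is bounded and Lipschitz in the angle, so Picard–Lindelöf reaches the whole interval.
Solving beyond `[α, β]` gives two-sided derivatives at the endpoints. -/
theorem exists_pruferAngle_Ioo (hαβ : α < β) (r θ₀ : ℝ) :
    ∃ θ : ℝ → ℝ, Continuous θ ∧ θ α = θ₀ ∧
      ∀ x ∈ Ioo (α - 1) (β + 1), HasDerivAt θ (pruferField K G L r x (θ x)) x := by
  have hle : α - 1 ≤ β + 1 := by linarith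
  obtain ⟨M, hM⟩ := (isCompact_Icc (a := α - 1) (b := β + 1)).exists_bound_of_continuousOn
    ((hC.continuous_inv_K.abs.add (hC.continuous_slope r).abs).continuousOn)
  have hM' : ∀ x ∈ Icc (α - 1) (β + 1), |1 / K x| + |r * G x - L x - 1 / K x| ≤ M :=
    fun x hx => (le_abs_self _).trans (hM x hx)
  have hM0 : 0 ≤ M := (add_nonneg (abs_nonneg _) (abs_nonneg _)).trans
    (hM' α ⟨by linarith, by linarith⟩)
  -- The radius is the bound `M` times the distance from `α` to the far end `β + 1`.
  have hPL : IsPicardLindelof (pruferField K G L r) (tmin := α - 1) (tmax := β + 1)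
      ⟨α, by linarith, by linarith⟩ θ₀ ⟨M * (β - α + 1), by nlinarith⟩ 0 ⟨M, hM0⟩ ⟨M, hM0⟩ := by
    refine ⟨fun t ht => ?_, fun x _ => ?_, fun t ht x _ => ?_, ?_⟩
    · refine LipschitzOnWith.of_dist_le_mul fun x _ y _ => ?_
      rw [Real.dist_eq, Real.dist_eq]
      have : pruferField K G L r t x - pruferField K G L r t y =
          (r * G t - L t - 1 / K t) * (Real.sin x ^ 2 - Real.sin y ^ 2) := by
        unfold pruferField; ring
      rw [this, abs_mul]
      exact mul_le_mul ((le_add_of_nonneg_left (abs_nonneg _)).trans (hM' t ht))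
        (abs_sin_sq_sub_sin_sq_le x y) (abs_nonneg _) hM0
    · exact (hC.continuous_inv_K.add ((hC.continuous_slope r).mul continuous_const)).continuousOn
    · refine (abs_add_le _ _).trans (le_trans ?_ (hM' t ht))
      rw [abs_mul, abs_of_nonneg (sq_nonneg (Real.sin x))]
      gcongr
      exact mul_le_of_le_one_right (abs_nonneg _) (Real.sin_sq_le_one x)
    · simp only [NNReal.coe_zero, sub_zero]
      exact mul_le_mul_of_nonneg_left (max_le (by simp; linarith) (by simp; linarith)) hM0
  obtain ⟨θ, h0, hθ⟩ := hPL.exists_eq_forall_mem_Icc_hasDerivWithinAt₀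
  refine ⟨IccExtend hle ((Icc (α - 1) (β + 1)).domRestrict θ), ?_, ?_, fun x hx => ?_⟩
  · exact Continuous.Icc_extend' (continuousOn_iff_continuous_domRestrict.1
      fun x hx => (hθ x hx).continuousWithinAt)
  · rw [IccExtend_of_mem _ _ ⟨by linarith, by linarith⟩]
    exact h0
  · have hx' : Icc (α - 1) (β + 1) ∈ 𝓝 x := Icc_mem_nhds hx.1 hx.2
    rw [IccExtend_of_mem _ _ (Ioo_subset_Icc_self hx)]
    refine ((hθ x (Ioo_subset_Icc_self hx)).hasDerivAt hx').congr_of_eventuallyEq ?_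
    filter_upwards [hx'] with t ht
    rw [IccExtend_of_mem _ _ ht]
    rfl

/-- The Prüfer angle crosses the multiples of `π` only upwards. -/
theorem IsPruferAngle.lt_of_le {r : ℝ} {θ : ℝ → ℝ} (hθ : IsPruferAngle α β K G L r θ)
    {x y : ℝ} (hx : α ≤ x) (hxy : x < y) (hy : y ≤ β) (k : ℤ) (hk : k * Real.pi ≤ θ x) :
    k * Real.pi < θ y := by
  -- As `sin² θ = sin² φ` for `φ = θ - k π`, `φ` solves a linear equation with forcing `1 / K > 0`.
  have := pos_of_linear (φ := fun t => θ t - k * Real.pi)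
    (c := fun t => (r * G t - L t - 1 / K t) *
      (Real.sin (θ t - k * Real.pi) * Real.sinc (θ t - k * Real.pi)))
    (d := fun t => 1 / K t) hxy
    ((hC.continuous_slope r).mul ((Real.continuous_sin.comp (hθ.continuous.sub continuous_const)).mul
      (Real.continuous_sinc.comp (hθ.continuous.sub continuous_const)))) (fun t ht => ?_)
    (fun t _ => one_div_pos.2 (hC.K_pos t)) (sub_nonneg.2 hk)
  · exact sub_pos.1 this
  · refine ((hθ.hasDerivAt t ⟨hx.trans ht.1, ht.2.trans hy⟩).sub_const (k * Real.pi)).congr_deriv ?_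
    have h1 : Real.sin (θ t) ^ 2 = Real.sin (θ t - k * Real.pi) ^ 2 := by
      rw [Real.sin_sub_int_mul_pi, mul_pow, ← sq_abs ((-1 : ℝ) ^ k), abs_zpow]
      simp
    unfold pruferField
    rw [h1]
    linear_combination -(r * G t - L t - 1 / K t) * Real.sin (θ t - k * Real.pi) *
      sinc_mul_self (θ t - k * Real.pi)

/-- For `φ = π/2 - θ` the equation at `r = 0` reads `φ' = -(L + 1/K) sin² φ + L`, with positive
forcing `L`. This supplies the low end for the intermediate value argument on eigenvalues. -/
theorem IsPruferAngle.lt_pi_div_two (hαβ : α < β) {θ : ℝ → ℝ}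
    (hθ : IsPruferAngle α β K G L 0 θ) (h0 : θ α ≤ Real.pi / 2) : θ β < Real.pi / 2 := by
  have := pos_of_linear (φ := fun t => Real.pi / 2 - θ t)
    (c := fun t => -(L t + 1 / K t) *
      (Real.sin (Real.pi / 2 - θ t) * Real.sinc (Real.pi / 2 - θ t)))
    (d := L) hαβ
    ((hC.contDiff_L.continuous.add hC.continuous_inv_K).neg.mul
      ((Real.continuous_sin.comp (continuous_const.sub hθ.continuous)).mul
      (Real.continuous_sinc.comp (continuous_const.sub hθ.continuous)))) (fun t ht => ?_)
    (fun t _ => hC.L_pos t) (sub_nonneg.2 h0)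
  · exact sub_pos.1 this
  · refine ((hθ.hasDerivAt t ht).const_sub (Real.pi / 2)).congr_deriv ?_
    unfold pruferField
    have h1 := sinc_mul_self (Real.pi / 2 - θ t)
    rw [Real.sin_pi_div_two_sub] at h1 ⊢
    linear_combination (L t + 1 / K t) * Real.cos (θ t) * h1
      + (L t + 1 / K t) * (Real.sin_sq_add_cos_sq (θ t))

/-- The difference `η - θ` solves a linear equation with forcing `(s - r) G sin² η ≥ 0`. If it
failed to become positive, the forcing would vanish identically; then `sin η = 0` on the interval,
although `η' = 1 / K` wherever `sin η = 0`. -/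
theorem IsPruferAngle.lt_of_lt (hαβ : α < β) {r s : ℝ} (hrs : r < s) {θ η : ℝ → ℝ}
    (hθ : IsPruferAngle α β K G L r θ) (hη : IsPruferAngle α β K G L s η) (h0 : θ α = η α) :
    θ β < η β := by
  by_contra hcon
  have hφ : ∀ t ∈ Icc α β, HasDerivAt (fun t => η t - θ t) ((r * G t - L t - 1 / K t) *
      (Real.sin (η t + θ t) * Real.sinc (η t - θ t)) * (η t - θ t) +
      (s - r) * G t * Real.sin (η t) ^ 2) t := fun t ht => by
    refine ((hη.hasDerivAt t ht).sub (hθ.hasDerivAt t ht)).congr_deriv ?_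
    unfold pruferField
    linear_combination -(r * G t - L t - 1 / K t) * (Real.sin (η t + θ t) *
      sinc_mul_self (η t - θ t) - sin_sq_sub_sin_sq (η t) (θ t))
  obtain ⟨E, hE, hder, hmono⟩ := exists_monotoneOn_mul_of_linear (φ := fun t => η t - θ t)
    (c := fun t => (r * G t - L t - 1 / K t) *
      (Real.sin (η t + θ t) * Real.sinc (η t - θ t)))
    (d := fun t => (s - r) * G t * Real.sin (η t) ^ 2) (a := α) (b := β)
    ((hC.continuous_slope r).mul ((Real.continuous_sin.comp (hη.continuous.add hθ.continuous)).mul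
      (Real.continuous_sinc.comp (hη.continuous.sub hθ.continuous)))) hφ
    (fun t _ => mul_nonneg (mul_nonneg (sub_pos.2 hrs).le (hC.G_pos t).le) (sq_nonneg _))
  have hzero : ∀ x ∈ Icc α β, E x * (η x - θ x) = 0 := fun x hx => by
    have h1 := hmono ⟨le_rfl, hαβ.le⟩ hx hx.1
    have h2 := hmono hx ⟨hαβ.le, le_rfl⟩ hx.2
    simp only [h0, sub_self, mul_zero] at h1
    have h3 : E β * (η β - θ β) ≤ 0 :=
      mul_nonpos_of_nonneg_of_nonpos (hE β).le (by linarith [not_lt.1 hcon])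
    exact le_antisymm (h2.trans h3) h1
  have hsin : ∀ x ∈ Ioo α β, Real.sin (η x) = 0 := fun x hx => by
    have h1 : (fun t => E t * (η t - θ t)) =ᶠ[𝓝 x] fun _ => (0 : ℝ) := by
      filter_upwards [Icc_mem_nhds hx.1 hx.2] with t ht using hzero t ht
    have h2 := (hder x (Ioo_subset_Icc_self hx)).deriv
    rw [h1.deriv_eq, deriv_const] at h2
    have h3 := sub_pos.2 hrs
    have h4 := hC.G_pos x
    have h5 := hE x
    by_contra hne
    have : 0 < E x * ((s - r) * G x * Real.sin (η x) ^ 2) := by positivity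
    linarith
  have hmid : (α + β) / 2 ∈ Ioo α β := ⟨by linarith, by linarith⟩
  have h1 : (fun t => Real.sin (η t)) =ᶠ[𝓝 ((α + β) / 2)] fun _ => (0 : ℝ) := by
    filter_upwards [Ioo_mem_nhds hmid.1 hmid.2] with t ht using hsin t ht
  have h2 := (hη.hasDerivAt _ (Ioo_subset_Icc_self hmid)).sin.deriv
  rw [h1.deriv_eq, deriv_const] at h2
  have h3 := Real.sin_sq_add_cos_sq (η ((α + β) / 2))
  unfold pruferField at h2
  rw [hsin _ hmid] at h2 h3
  have h5 : Real.cos (η ((α + β) / 2)) = 0 := by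
    simpa [(hC.K_pos ((α + β) / 2)).ne'] using h2.symm
  rw [h5] at h3
  norm_num at h3

/-- Grönwall's inequality: along the two solutions the fields differ by a Lipschitz term plus at
most `|s - r| * N`. -/
theorem continuous_pruferAngle_param (hαβ : α < β) {θ : ℝ → ℝ → ℝ} {θ₀ : ℝ}
    (hθ : ∀ r, IsPruferAngle α β K G L r (θ r)) (h0 : ∀ r, θ r α = θ₀) :
    Continuous fun r => θ r β := by
  rw [continuous_iff_continuousAt]
  intro r
  obtain ⟨M, hM⟩ := (isCompact_Icc (a := α) (b := β)).exists_bound_of_continuousOn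
    ((hC.continuous_slope r).continuousOn)
  obtain ⟨N, hN⟩ := (isCompact_Icc (a := α) (b := β)).exists_bound_of_continuousOn
    (hC.contDiff_G.continuous.continuousOn)
  have hbound : ∀ s, |θ s β - θ r β| ≤ gronwallBound 0 M (|s - r| * N) (β - α) := fun s => by
    refine norm_le_gronwallBound_of_norm_deriv_right_le (f := fun t => θ s t - θ r t)
      (f' := fun t => pruferField K G L s t (θ s t) - pruferField K G L r t (θ r t))
      (((hθ s).continuous.sub (hθ r).continuous).continuousOn)
      (fun x hx => (((hθ s).hasDerivAt x (Ico_subset_Icc_self hx)).sub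
        ((hθ r).hasDerivAt x (Ico_subset_Icc_self hx))).hasDerivWithinAt)
      (by simp [h0]) (fun x hx => ?_) β ⟨hαβ.le, le_rfl⟩
    have h1 : pruferField K G L s x (θ s x) - pruferField K G L r x (θ r x) =
        (r * G x - L x - 1 / K x) * (Real.sin (θ s x) ^ 2 - Real.sin (θ r x) ^ 2) +
          (s - r) * (G x * Real.sin (θ s x) ^ 2) := by
      unfold pruferField; ring
    rw [h1]
    refine (norm_add_le _ _).trans (add_le_add ?_ ?_)
    · rw [norm_mul]
      exact mul_le_mul (hM x (Ico_subset_Icc_self hx)) (abs_sin_sq_sub_sin_sq_le _ _)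
        (norm_nonneg _) ((norm_nonneg _).trans (hM x (Ico_subset_Icc_self hx)))
    · rw [norm_mul, Real.norm_eq_abs, norm_mul]
      refine mul_le_mul_of_nonneg_left ?_ (abs_nonneg _)
      refine (mul_le_of_le_one_right (norm_nonneg _) ?_).trans (hN x (Ico_subset_Icc_self hx))
      rw [Real.norm_eq_abs, abs_of_nonneg (sq_nonneg _)]
      exact Real.sin_sq_le_one _
  have hlim : Tendsto (fun s => gronwallBound 0 M (|s - r| * N) (β - α)) (𝓝 r) (𝓝 0) := by
    have h1 : Continuous fun s => gronwallBound 0 M (|s - r| * N) (β - α) :=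
      (gronwallBound_continuous_ε 0 M (β - α)).comp (by fun_prop)
    have h2 := h1.tendsto r
    simpa [gronwallBound_ε0_δ0] using h2
  refine tendsto_iff_dist_tendsto_zero.2 (squeeze_zero (fun _ => dist_nonneg) (fun s => ?_) hlim)
  rw [Real.dist_eq]
  exact hbound s

end

/-! ### Smooth extensions -/

theorem exists_smooth_cutoff {a α β b : ℝ} (ha : a < α) (hαβ : α < β) (hb : β < b) :
    ∃ χ : ℝ → ℝ, ContDiff ℝ ∞ χ ∧ (∀ x, χ x ∈ Icc (0 : ℝ) 1) ∧ tsupport χ ⊆ Ioo a b ∧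
      ∀ x ∈ Icc α β, ∀ᶠ t in 𝓝 x, χ t = 1 := by
  set δ := min (α - a) (b - β)
  have hδ : 0 < δ := lt_min (by linarith) (by linarith)
  have hδ1 : δ ≤ α - a := min_le_left _ _
  have hδ2 : δ ≤ b - β := min_le_right _ _
  let f : ContDiffBump ((α + β) / 2) :=
    ⟨(β - α) / 2 + δ / 3, (β - α) / 2 + δ / 2, by linarith, by linarith⟩
  refine ⟨f, f.contDiff, fun x => ⟨f.nonneg, f.le_one⟩, ?_, fun x hx => ?_⟩
  · rw [f.tsupport_eq, Real.closedBall_eq_Icc]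
    intro x hx
    have h1 : (α + β) / 2 - ((β - α) / 2 + δ / 2) ≤ x := hx.1
    have h2 : x ≤ (α + β) / 2 + ((β - α) / 2 + δ / 2) := hx.2
    exact ⟨by linarith, by linarith⟩
  · apply f.eventuallyEq_one_of_mem_ball
    rw [Real.ball_eq_Ioo]
    show x ∈ Ioo ((α + β) / 2 - ((β - α) / 2 + δ / 3)) ((α + β) / 2 + ((β - α) / 2 + δ / 3))
    exact ⟨by linarith [hx.1], by linarith [hx.2]⟩

theorem contDiff_cutoff_mul {a b : ℝ} {χ f : ℝ → ℝ} (hχ : ContDiff ℝ ∞ χ)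
    (hsupp : tsupport χ ⊆ Ioo a b) (hf : ContDiffOn ℝ ∞ f (Ioo a b)) :
    ContDiff ℝ ∞ fun x => χ x * f x := by
  rw [contDiff_iff_contDiffAt]
  intro x
  by_cases hx : x ∈ Ioo a b
  · exact hχ.contDiffAt.mul (hf.contDiffAt (Ioo_mem_nhds hx.1 hx.2))
  · have h1 : χ =ᶠ[𝓝 x] 0 := notMem_tsupport_iff_eventuallyEq.1 fun h => hx (hsupp h)
    refine (contDiffAt_const (c := (0 : ℝ))).congr_of_eventuallyEq ?_
    filter_upwards [h1] with t ht
    simp [ht]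

/-- The convex combination `χ f + (1 - χ)` of `f` and `1` stays positive where nothing is known
about `f`. -/
theorem exists_smooth_pos_extension {a α β b : ℝ} (ha : a < α) (hαβ : α < β) (hb : β < b)
    {f : ℝ → ℝ} (hf : ContDiffOn ℝ ∞ f (Ioo a b)) (hpos : ∀ x ∈ Ioo a b, 0 < f x) :
    ∃ g : ℝ → ℝ, ContDiff ℝ ∞ g ∧ (∀ x, 0 < g x) ∧ EqOn f g (Icc α β) := by
  obtain ⟨χ, hχ, hχ01, hsupp, hone⟩ := exists_smooth_cutoff ha hαβ hb
  refine ⟨fun x => χ x * f x + (1 - χ x),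
    (contDiff_cutoff_mul hχ hsupp hf).add (contDiff_const.sub hχ), fun x => ?_, fun x hx => ?_⟩
  · by_cases hx : x ∈ Ioo a b
    · rcases (hχ01 x).1.eq_or_lt with h0 | h0
      · simp [← h0]
      · have := mul_pos h0 (hpos x hx)
        linarith [(hχ01 x).2]
    · have h0 : χ x = 0 := image_eq_zero_of_notMem_tsupport fun h => hx (hsupp h)
      simp [h0]
  · simp [(hone x hx).self_of_nhds]

/-- Eigenfunctions only see the coefficients on `[α, β]`, so the problem may be moved to
coefficients on the whole line. -/
theorem Admissible.exists_smoothCoeffs {α₀ α β β₀ : ℝ} {K G L : ℝ → ℝ}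
    (hadm : Admissible α₀ α β β₀ K G L) :
    ∃ K' G' L' : ℝ → ℝ, SmoothCoeffs K' G' L' ∧ EqOn K K' (Icc α β) ∧ EqOn G G' (Icc α β) ∧
      EqOn L L' (Icc α β) := by
  obtain ⟨h1, h2, h3, hK, hG, hL, hpos⟩ := hadm
  obtain ⟨K', hK', hK'pos, hKK'⟩ := exists_smooth_pos_extension h1 h2 h3 hK fun x hx => (hpos x hx).1
  obtain ⟨G', hG', hG'pos, hGG'⟩ :=
    exists_smooth_pos_extension h1 h2 h3 hG fun x hx => (hpos x hx).2.1
  obtain ⟨L', hL', hL'pos, hLL'⟩ :=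
    exists_smooth_pos_extension h1 h2 h3 hL fun x hx => (hpos x hx).2.2
  exact ⟨K', G', L', ⟨hK', hG', hL', hK'pos, hG'pos, hL'pos⟩, hKK', hGG', hLL'⟩

/-! ### Solutions from the Prüfer angle -/

/-- Solutions of a smooth first order linear system are smooth. -/
theorem contDiffOn_of_linear_system {a b : ℝ} {S C p q : ℝ → ℝ} (hp : ContDiff ℝ ∞ p)
    (hq : ContDiff ℝ ∞ q) (hS : ∀ x ∈ Ioo a b, HasDerivAt S (p x * C x) x)
    (hC : ∀ x ∈ Ioo a b, HasDerivAt C (q x * S x) x) : ContDiffOn ℝ ∞ S (Ioo a b) := by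
  rw [contDiffOn_infty]
  suffices h : ∀ n : ℕ, ContDiffOn ℝ n S (Ioo a b) ∧ ContDiffOn ℝ n C (Ioo a b) from
    fun n => (h n).1
  intro n
  induction n with
  | zero =>
    simp only [Nat.cast_zero, contDiffOn_zero]
    exact ⟨fun x hx => (hS x hx).continuousAt.continuousWithinAt,
      fun x hx => (hC x hx).continuousAt.continuousWithinAt⟩
  | succ n ih =>
    have hle : ((n : ℕ∞) : WithTop ℕ∞) ≤ (∞ : WithTop ℕ∞) := by exact_mod_cast le_top
    -- Each component gains one derivative from the other.
    have key : ∀ f g c : ℝ → ℝ, ContDiff ℝ ∞ c → ContDiffOn ℝ n g (Ioo a b) →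
        (∀ x ∈ Ioo a b, HasDerivAt f (c x * g x) x) → ContDiffOn ℝ (n + 1 : ℕ) f (Ioo a b) := by
      intro f g c hc hg hf
      rw [Nat.cast_add, Nat.cast_one, contDiffOn_succ_iff_deriv_of_isOpen isOpen_Ioo]
      refine ⟨fun x hx => (hf x hx).differentiableAt.differentiableWithinAt, by simp, ?_⟩
      exact ((hc.of_le hle).contDiffOn.mul hg).congr fun x hx => (hf x hx).deriv
    exact ⟨key S C p hp ih.2 hS, key C S q hq ih.1 hC⟩

/-- `R` is chosen so that `R sin θ` and `R cos θ` solve the first order system for `S` and `K S'`. A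
cutoff equal to `1` near `[α, β]` makes `S` globally smooth and keeps the equation valid around the
endpoints. -/
theorem exists_prufer_solution {α β : ℝ} {K G L : ℝ → ℝ} (hC : SmoothCoeffs K G L)
    (hαβ : α < β) (r θ₀ : ℝ) :
    ∃ θ R S : ℝ → ℝ, IsPruferAngle α β K G L r θ ∧ θ α = θ₀ ∧ ContDiff ℝ ∞ S ∧
      (∀ x ∈ Icc α β, ∀ᶠ t in 𝓝 x,
        deriv (fun t => K t * deriv S t) t = (L t - r * G t) * S t) ∧
      ∀ x ∈ Icc α β, 0 < R x ∧ S x = R x * Real.sin (θ x) ∧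
        K x * deriv S x = R x * Real.cos (θ x) := by
  obtain ⟨θ, hcont, h0, hθ⟩ := exists_pruferAngle_Ioo hC hαβ r θ₀
  have hsub : Icc α β ⊆ Ioo (α - 1) (β + 1) := fun x hx =>
    ⟨by linarith [hx.1], by linarith [hx.2]⟩
  obtain ⟨R, hRpos, hR⟩ := exists_integratingFactor
    (c := fun x => (r * G x - L x - 1 / K x) * (Real.sin (θ x) * Real.cos (θ x)))
    ((hC.continuous_slope r).mul ((Real.continuous_sin.comp hcont).mul
      (Real.continuous_cos.comp hcont)))
  have hS : ∀ x ∈ Ioo (α - 1) (β + 1), HasDerivAt (fun t => R t * Real.sin (θ t))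
      (1 / K x * (R x * Real.cos (θ x))) x := fun x hx => by
    refine ((hR x).mul (hθ x hx).sin).congr_deriv ?_
    unfold pruferField
    ring
  have hCos : ∀ x ∈ Ioo (α - 1) (β + 1), HasDerivAt (fun t => R t * Real.cos (θ t))
      ((L x - r * G x) * (R x * Real.sin (θ x))) x := fun x hx => by
    refine ((hR x).mul (hθ x hx).cos).congr_deriv ?_
    unfold pruferField
    linear_combination (-(r * G x - L x - 1 / K x) * R x * Real.sin (θ x)) *
      Real.sin_sq_add_cos_sq (θ x)
  have hsm : ContDiffOn ℝ ∞ (fun t => R t * Real.sin (θ t)) (Ioo (α - 1) (β + 1)) :=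
    contDiffOn_of_linear_system (contDiff_const.div hC.contDiff_K fun x => (hC.K_pos x).ne')
      (hC.contDiff_L.sub (contDiff_const.mul hC.contDiff_G)) hS hCos
  obtain ⟨χ, hχ, -, hsupp, hone⟩ := exists_smooth_cutoff (sub_one_lt α) hαβ (lt_add_one β)
  have heq : ∀ x ∈ Icc α β, (fun t => χ t * (R t * Real.sin (θ t))) =ᶠ[𝓝 x]
      fun t => R t * Real.sin (θ t) := fun x hx => by
    filter_upwards [hone x hx] with t ht
    rw [ht, one_mul]
  have hder : ∀ x ∈ Icc α β, ∀ᶠ t in 𝓝 x,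
      K t * deriv (fun t => χ t * (R t * Real.sin (θ t))) t = R t * Real.cos (θ t) :=
    fun x hx => by
      filter_upwards [(heq x hx).eventuallyEq_nhds, Ioo_mem_nhds (hsub hx).1 (hsub hx).2]
        with t ht ht'
      rw [ht.deriv_eq, (hS t ht').deriv]
      field_simp [(hC.K_pos t).ne']
  refine ⟨θ, R, fun t => χ t * (R t * Real.sin (θ t)), ⟨hcont, fun x hx => hθ x (hsub hx)⟩, h0,
    contDiff_cutoff_mul hχ hsupp hsm, fun x hx => ?_, fun x hx => ⟨hRpos x,
      (heq x hx).self_of_nhds, (hder x hx).self_of_nhds⟩⟩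
  have hder' : (fun t => K t * deriv (fun t => χ t * (R t * Real.sin (θ t))) t) =ᶠ[𝓝 x]
    fun t => R t * Real.cos (θ t) := hder x hx
  filter_upwards [hder'.eventuallyEq_nhds, heq x hx,
    Ioo_mem_nhds (hsub hx).1 (hsub hx).2] with t ht ht' ht''
  rw [ht.deriv_eq, (hCos t ht'').deriv, ht']

/-! ### Modes -/

/-- The Prüfer angle in `[0, π/2]` which encodes the boundary condition at the left endpoint. -/
noncomputable def leftAngle (h : ENNReal) : ℝ :=
  open Classical in if h = ⊤ then 0 else Real.pi / 2 - Real.arctan h.toReal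

/-- The Prüfer angle in `[π/2, π]` which encodes the boundary condition at the right endpoint. -/
noncomputable def rightAngle (H : ENNReal) : ℝ :=
  open Classical in if H = ⊤ then Real.pi else Real.pi / 2 + Real.arctan H.toReal

theorem arctan_toReal_nonneg (h : ENNReal) : 0 ≤ Real.arctan h.toReal :=
  Real.arctan_nonneg.2 ENNReal.toReal_nonneg

theorem leftAngle_nonneg (h : ENNReal) : 0 ≤ leftAngle h := by
  unfold leftAngle
  split_ifs
  · exact le_rfl
  · linarith [Real.arctan_lt_pi_div_two h.toReal]

theorem leftAngle_le (h : ENNReal) : leftAngle h ≤ Real.pi / 2 := by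
  unfold leftAngle
  split_ifs
  · exact Real.pi_div_two_pos.le
  · linarith [arctan_toReal_nonneg h]

theorem le_rightAngle (H : ENNReal) : Real.pi / 2 ≤ rightAngle H := by
  unfold rightAngle
  split_ifs
  · linarith [Real.pi_pos]
  · linarith [arctan_toReal_nonneg H]

theorem rightAngle_le (H : ENNReal) : rightAngle H ≤ Real.pi := by
  unfold rightAngle
  split_ifs
  · exact le_rfl
  · linarith [Real.arctan_lt_pi_div_two H.toReal]

theorem sin_leftAngle_pos {h : ENNReal} (hh : h ≠ ⊤) : 0 < Real.sin (leftAngle h) := by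
  rw [leftAngle, if_neg hh, Real.sin_pi_div_two_sub]
  exact Real.cos_arctan_pos _

theorem sin_rightAngle_pos {H : ENNReal} (hH : H ≠ ⊤) : 0 < Real.sin (rightAngle H) := by
  rw [rightAngle, if_neg hH, add_comm, Real.sin_add_pi_div_two]
  exact Real.cos_arctan_pos _

/-- One homogeneous linear relation covers the Dirichlet and Robin cases, so Wronskians and linear
combinations need no case distinction. -/
theorem leftBC_iff_angle {h : ENNReal} {v w : ℝ} :
    ((h = ⊤ → v = 0) ∧ (h ≠ ⊤ → w - h.toReal * v = 0)) ↔
      v * Real.cos (leftAngle h) = w * Real.sin (leftAngle h) := by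
  by_cases hh : h = ⊤
  · simp [hh, leftAngle]
  · have hc := Real.cos_arctan_pos h.toReal
    have ht := Real.tan_arctan h.toReal
    rw [Real.tan_eq_sin_div_cos, div_eq_iff hc.ne'] at ht
    rw [leftAngle, if_neg hh, Real.cos_pi_div_two_sub, Real.sin_pi_div_two_sub, ht]
    constructor
    · rintro ⟨-, h2⟩
      linear_combination -Real.cos (Real.arctan h.toReal) * h2 hh
    · intro h2
      refine ⟨fun h => absurd h hh, fun _ => mul_left_cancel₀ hc.ne' ?_⟩
      linear_combination -h2

theorem rightBC_iff_angle {H : ENNReal} {v w : ℝ} :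
    ((H = ⊤ → v = 0) ∧ (H ≠ ⊤ → w + H.toReal * v = 0)) ↔
      v * Real.cos (rightAngle H) = w * Real.sin (rightAngle H) := by
  by_cases hh : H = ⊤
  · simp [hh, rightAngle]
  · have hc := Real.cos_arctan_pos H.toReal
    have ht := Real.tan_arctan H.toReal
    rw [Real.tan_eq_sin_div_cos, div_eq_iff hc.ne'] at ht
    rw [rightAngle, if_neg hh, add_comm (Real.pi / 2), Real.cos_add_pi_div_two, Real.sin_add_pi_div_two, ht]
    constructor
    · rintro ⟨-, h2⟩
      linear_combination -Real.cos (Real.arctan H.toReal) * h2 hh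
    · intro h2
      refine ⟨fun h => absurd h hh, fun _ => mul_left_cancel₀ hc.ne' ?_⟩
      linear_combination -h2

/-- A function on the line which is smooth, solves the differential equation in a neighbourhood of
`[α, β]`, satisfies the boundary conditions, and is nontrivial at each point of `[α, β]`. -/
structure IsMode (α β : ℝ) (K G L : ℝ → ℝ) (h H : ENNReal) (r : ℝ) (V : ℝ → ℝ) : Prop where
  contDiff : ContDiff ℝ ∞ V
  ode : ∀ x ∈ Icc α β, ∀ᶠ t in 𝓝 x,
    deriv (fun t => K t * deriv V t) t = (L t - r * G t) * V t
  left : V α * Real.cos (leftAngle h) = K α * deriv V α * Real.sin (leftAngle h)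
  right : V β * Real.cos (rightAngle H) = K β * deriv V β * Real.sin (rightAngle H)
  ne_zero : ∀ x ∈ Icc α β, V x ≠ 0 ∨ deriv V x ≠ 0

/-! ### Eigenfunctions and the Prüfer angle -/

/-- A solution `S` satisfying the boundary condition at `α`, with Prüfer angle `θ` and radius `R`. -/
structure IsPruferSolution (α β : ℝ) (K G L : ℝ → ℝ) (h : ENNReal) (r : ℝ) (θ R S : ℝ → ℝ) :
    Prop where
  angle : IsPruferAngle α β K G L r θ
  init : θ α = leftAngle h
  contDiff : ContDiff ℝ ∞ S
  ode : ∀ x ∈ Icc α β, ∀ᶠ t in 𝓝 x,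
    deriv (fun t => K t * deriv S t) t = (L t - r * G t) * S t
  radius_pos : ∀ x ∈ Icc α β, 0 < R x
  eq_sin : ∀ x ∈ Icc α β, S x = R x * Real.sin (θ x)
  eq_cos : ∀ x ∈ Icc α β, K x * deriv S x = R x * Real.cos (θ x)

/-- `f` takes values of alternating strict signs at `j + 1` successive points of `]α, β[`. -/
def Alternates (α β : ℝ) (f : ℝ → ℝ) (j : ℕ) : Prop :=
  ∃ (t : ℕ → ℝ) (ε : ℝ), (∀ i ≤ j, t i ∈ Ioo α β) ∧ (∀ i < j, t i < t (i + 1)) ∧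
    ∀ i ≤ j, 0 < ε * (-1) ^ i * f (t i)

theorem eq_of_hasDerivAt_zero {f : ℝ → ℝ} {a b : ℝ} (hf : ContinuousOn f (Icc a b))
    (hf' : ∀ x ∈ Ioo a b, HasDerivAt f 0 x) : ∀ x ∈ Icc a b, f x = f a := by
  intro x hx
  have hd : DifferentiableOn ℝ f (interior (Icc a b)) := fun y hy => by
    rw [interior_Icc] at hy
    exact (hf' y hy).differentiableAt.differentiableWithinAt
  have ha : a ∈ Icc a b := ⟨le_rfl, hx.1.trans hx.2⟩
  refine le_antisymm
    (antitoneOn_of_deriv_nonpos (convex_Icc a b) hf hd (fun y hy => ?_) ha hx hx.1)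
    (monotoneOn_of_deriv_nonneg (convex_Icc a b) hf hd (fun y hy => ?_) ha hx hx.1) <;>
  · rw [interior_Icc] at hy
    rw [(hf' y hy).deriv]

theorem IsEigenfunction.congr_coeffs {α β : ℝ} {K G L K' G' L' : ℝ → ℝ} {h H : ENNReal} {r : ℝ}
    {V : ℝ → ℝ} (hV : IsEigenfunction α β K G L h H r V) (hαβ : α < β)
    (hK : EqOn K K' (Icc α β)) (hG : EqOn G G' (Icc α β)) (hL : EqOn L L' (Icc α β)) :
    IsEigenfunction α β K' G' L' h H r V := by
  obtain ⟨h1, h2, h3, h4, h5⟩ := hV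
  refine ⟨h1, h2, fun x hx => ?_, ?_, ?_⟩
  · have hx' := Ioo_subset_Icc_self hx
    have : (fun t => K' t * deriv V t) =ᶠ[𝓝 x] fun t => K t * deriv V t := by
      filter_upwards [Icc_mem_nhds hx.1 hx.2] with t ht
      rw [hK ht]
    rw [this.deriv_eq, ← hG hx', ← hL hx']
    exact h3 x hx
  · rw [LeftBC, ← hK ⟨le_rfl, hαβ.le⟩]
    exact h4
  · rw [RightBC, ← hK ⟨hαβ.le, le_rfl⟩]
    exact h5

theorem eigenvalues_congr_coeffs {α β : ℝ} {K G L K' G' L' : ℝ → ℝ} {h H : ENNReal}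
    (hαβ : α < β) (hK : EqOn K K' (Icc α β)) (hG : EqOn G G' (Icc α β))
    (hL : EqOn L L' (Icc α β)) : eigenvalues α β K G L h H = eigenvalues α β K' G' L' h H := by
  ext r
  exact ⟨fun ⟨V, hV⟩ => ⟨V, hV.congr_coeffs hαβ hK hG hL⟩,
    fun ⟨V, hV⟩ => ⟨V, hV.congr_coeffs hαβ hK.symm hG.symm hL.symm⟩⟩

theorem IsNthEigenfunction.congr_coeffs {α β : ℝ} {K G L K' G' L' : ℝ → ℝ} {h H : ENNReal} {p : ℕ}
    {V : ℝ → ℝ} (hV : IsNthEigenfunction α β K G L h H p V) (hαβ : α < β)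
    (hK : EqOn K K' (Icc α β)) (hG : EqOn G G' (Icc α β)) (hL : EqOn L L' (Icc α β)) :
    IsNthEigenfunction α β K' G' L' h H p V := by
  obtain ⟨r, hr, hV⟩ := hV
  refine ⟨r, ?_, hV.congr_coeffs hαβ hK hG hL⟩
  rw [IsNthEigenvalue, ← eigenvalues_congr_coeffs hαβ hK hG hL]
  exact hr

section

variable {α β : ℝ} {K G L : ℝ → ℝ} {h H : ENNReal} {r : ℝ}

theorem IsMode.const_mul {V : ℝ → ℝ} (hV : IsMode α β K G L h H r V) {c : ℝ} (hc : c ≠ 0) :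
    IsMode α β K G L h H r (fun x => c * V x) := by
  have hd : deriv (fun x => c * V x) = fun x => c * deriv V x := by
    ext x; exact deriv_const_mul_field c
  refine ⟨contDiff_const.mul hV.contDiff, fun x hx => ?_, ?_, ?_, fun x hx => ?_⟩
  · filter_upwards [hV.ode x hx] with t ht
    have : (fun t => K t * deriv (fun x => c * V x) t) = fun t => c * (K t * deriv V t) := by
      ext t; rw [hd]; ring
    rw [this, deriv_const_mul_field, ht]
    ring
  · rw [hd]; linear_combination c * hV.left
  · rw [hd]; linear_combination c * hV.right
  · rw [hd]
    rcases hV.ne_zero x hx with h1 | h1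
    · exact Or.inl (mul_ne_zero hc h1)
    · exact Or.inr (mul_ne_zero hc h1)

theorem IsMode.isEigenfunction (hαβ : α < β) {V : ℝ → ℝ} (hV : IsMode α β K G L h H r V) :
    IsEigenfunction α β K G L h H r V := by
  have hd := hV.contDiff.differentiable (by simp)
  have hα : α ∈ Icc α β := ⟨le_rfl, hαβ.le⟩
  have hβ : β ∈ Icc α β := ⟨hαβ.le, le_rfl⟩
  refine ⟨(contDiff_infty.1 hV.contDiff 2).contDiffOn, ?_, fun x hx => ?_, ?_, ?_⟩
  · by_contra! hzero
    have hmid : (α + β) / 2 ∈ Ioo α β := ⟨by linarith, by linarith⟩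
    have hev : V =ᶠ[𝓝 ((α + β) / 2)] fun _ => 0 := by
      filter_upwards [Icc_mem_nhds hmid.1 hmid.2] with t ht using hzero t ht
    rcases hV.ne_zero _ (Ioo_subset_Icc_self hmid) with h1 | h1
    · exact h1 hev.self_of_nhds
    · rw [hev.deriv_eq, deriv_const] at h1
      exact h1 rfl
  · rw [(hV.ode x (Ioo_subset_Icc_self hx)).self_of_nhds]
    ring
  · rw [LeftBC, (hd α).derivWithin (uniqueDiffOn_Icc hαβ α hα)]
    exact leftBC_iff_angle.2 hV.left
  · rw [RightBC, (hd β).derivWithin (uniqueDiffOn_Icc hαβ β hβ)]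
    exact rightBC_iff_angle.2 hV.right

theorem IsPruferSolution.isMode (hαβ : α < β) {θ R S : ℝ → ℝ}
    (hS : IsPruferSolution α β K G L h r θ R S) (hβ : Real.sin (rightAngle H - θ β) = 0) :
    IsMode α β K G L h H r S := by
  have hα' : α ∈ Icc α β := ⟨le_rfl, hαβ.le⟩
  have hβ' : β ∈ Icc α β := ⟨hαβ.le, le_rfl⟩
  refine ⟨hS.contDiff, hS.ode, ?_, ?_, fun x hx => ?_⟩
  · rw [hS.eq_sin α hα', hS.eq_cos α hα', hS.init]; ring
  · rw [hS.eq_sin β hβ', hS.eq_cos β hβ']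
    rw [Real.sin_sub] at hβ
    linear_combination -R β * hβ
  · by_contra! hc
    have h1 := hS.eq_sin x hx
    have h2 := hS.eq_cos x hx
    have h3 := (hS.radius_pos x hx).ne'
    rw [hc.1] at h1
    rw [hc.2, mul_zero] at h2
    have h4 : Real.sin (θ x) = 0 := by simpa [h3] using h1.symm
    have h5 : Real.cos (θ x) = 0 := by simpa [h3] using h2.symm
    have := Real.sin_sq_add_cos_sq (θ x)
    rw [h4, h5] at this
    norm_num at this

/-- An eigenfunction is a multiple of the Prüfer solution. -/
theorem IsPruferSolution.exists_eqOn_of_isEigenfunction (hC : SmoothCoeffs K G L) (hαβ : α < β)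
    {θ R S V : ℝ → ℝ} (hS : IsPruferSolution α β K G L h r θ R S)
    (hV : IsEigenfunction α β K G L h H r V) :
    (∃ c : ℝ, c ≠ 0 ∧ EqOn V (fun x => c * S x) (Icc α β)) ∧
      Real.sin (rightAngle H - θ β) = 0 := by
  obtain ⟨hV2, hVne, hode, hl, hr⟩ := hV
  have hα' : α ∈ Icc α β := ⟨le_rfl, hαβ.le⟩
  have hβ' : β ∈ Icc α β := ⟨hαβ.le, le_rfl⟩
  have hSd := hS.contDiff.differentiable (by simp)
  have hKd := hC.contDiff_K.differentiable (by simp)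
  have hS'd := (contDiff_deriv hS.contDiff).differentiable (by simp)
  obtain ⟨W, hWdef⟩ : ∃ W : ℝ → ℝ, W = fun x => K x * derivWithin V (Icc α β) x := ⟨_, rfl⟩
  obtain ⟨C, hCdef⟩ : ∃ C : ℝ → ℝ, C = fun x => K x * deriv S x := ⟨_, rfl⟩
  have hVc : ContinuousOn V (Icc α β) := hV2.continuousOn
  have hWc : ContinuousOn W (Icc α β) := by
    rw [hWdef]
    exact hC.contDiff_K.continuous.continuousOn.mul
      (hV2.continuousOn_derivWithin (uniqueDiffOn_Icc hαβ) (by norm_num))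
  have hCc : Continuous C := by
    rw [hCdef]; exact hC.contDiff_K.continuous.mul hS'd.continuous
  have hV' : ∀ x ∈ Ioo α β, HasDerivAt V (W x / K x) x := fun x hx => by
    have hn := Icc_mem_nhds hx.1 hx.2
    have h1 : DifferentiableAt ℝ V x := (hV2.contDiffAt hn).differentiableAt (by norm_num)
    have h2 : W x / K x = deriv V x := by
      rw [hWdef]
      simp only
      rw [derivWithin_of_mem_nhds hn, mul_div_cancel_left₀ _ (hC.K_pos x).ne']
    rw [h2]
    exact h1.hasDerivAt
  have hW' : ∀ x ∈ Ioo α β, HasDerivAt W ((L x - r * G x) * V x) x := fun x hx => by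
    have h1 : ContDiffAt ℝ 1 (deriv V) x := by
      have h0 : ContDiffOn ℝ (1 + 1) V (Ioo α β) := by
        rw [one_add_one_eq_two]
        exact hV2.mono Ioo_subset_Icc_self
      exact ((contDiffOn_succ_iff_deriv_of_isOpen isOpen_Ioo).1 h0).2.2.contDiffAt
        (Ioo_mem_nhds hx.1 hx.2)
    have h2 : DifferentiableAt ℝ (fun t => K t * deriv V t) x :=
      (hKd x).mul (h1.differentiableAt (by norm_num))
    have h3 : W =ᶠ[𝓝 x] fun t => K t * deriv V t := by
      filter_upwards [Ioo_mem_nhds hx.1 hx.2] with t ht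
      rw [hWdef]
      simp only
      rw [derivWithin_of_mem_nhds (Icc_mem_nhds ht.1 ht.2)]
    refine (h2.hasDerivAt.congr_of_eventuallyEq h3).congr_deriv ?_
    linear_combination hode x hx
  have hS' : ∀ x, HasDerivAt S (C x / K x) x := fun x => by
    rw [hCdef]
    simp only
    rw [mul_div_cancel_left₀ _ (hC.K_pos x).ne']
    exact (hSd x).hasDerivAt
  have hC' : ∀ x ∈ Ioo α β, HasDerivAt C ((L x - r * G x) * S x) x := fun x hx => by
    rw [← (hS.ode x (Ioo_subset_Icc_self hx)).self_of_nhds, hCdef]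
    exact ((hKd x).mul (hS'd x)).hasDerivAt
  -- The Wronskian of `V` and `S` is constant, and zero at `α`, where both satisfy the same
  -- condition.
  have hwr : ∀ x ∈ Icc α β, V x * C x - W x * S x = 0 := by
    have h1 := eq_of_hasDerivAt_zero (f := fun x => V x * C x - W x * S x) (a := α) (b := β)
      ((hVc.mul hCc.continuousOn).sub (hWc.mul hSd.continuous.continuousOn)) fun x hx => by
        refine (((hV' x hx).mul (hC' x hx)).sub ((hW' x hx).mul (hS' x))).congr_deriv ?_
        ring
    intro x hx
    rw [h1 x hx]
    have h2 := leftBC_iff_angle.1 hl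
    have h3 : C α = R α * Real.cos (θ α) := by rw [hCdef]; exact hS.eq_cos α hα'
    rw [h3, hS.eq_sin α hα', hS.init, hWdef]
    linear_combination R α * h2
  have hpos : ∀ x ∈ Icc α β, 0 < S x ^ 2 + C x ^ 2 := fun x hx => by
    have h3 : C x = R x * Real.cos (θ x) := by rw [hCdef]; exact hS.eq_cos x hx
    rw [h3, hS.eq_sin x hx, mul_pow, mul_pow, ← mul_add, Real.sin_sq_add_cos_sq, mul_one]
    exact pow_pos (hS.radius_pos x hx) 2
  -- `q` is the coefficient of the projection of `(V, W)` on `(S, C)`; unlike that of `V / S`, its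
  -- denominator never vanishes.
  obtain ⟨q, hqdef⟩ : ∃ q : ℝ → ℝ, q = fun x => (V x * S x + W x * C x) / (S x ^ 2 + C x ^ 2) :=
    ⟨_, rfl⟩
  have hqS : ∀ x ∈ Icc α β, V x = q x * S x := fun x hx => by
    have h1 := (hpos x hx).ne'
    rw [hqdef]
    field_simp
    linear_combination C x * hwr x hx
  have hqC : ∀ x ∈ Icc α β, W x = q x * C x := fun x hx => by
    have h1 := (hpos x hx).ne'
    rw [hqdef]
    field_simp
    linear_combination -S x * hwr x hx
  have hqconst := eq_of_hasDerivAt_zero (f := q) (a := α) (b := β) (by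
      rw [hqdef]
      exact ((hVc.mul hSd.continuous.continuousOn).add (hWc.mul hCc.continuousOn)).div
        ((hSd.continuous.pow 2).add (hCc.pow 2)).continuousOn fun x hx => (hpos x hx).ne')
    fun x hx => by
      have hxI := Ioo_subset_Icc_self hx
      have hqd : DifferentiableAt ℝ q x := by
        rw [hqdef]
        exact (((hV' x hx).mul (hS' x)).add ((hW' x hx).mul (hC' x hx))).differentiableAt.div
          (((hS' x).pow 2).add ((hC' x hx).pow 2)).differentiableAt (hpos x hxI).ne'
      have h1 : V =ᶠ[𝓝 x] fun t => q t * S t := by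
        filter_upwards [Icc_mem_nhds hx.1 hx.2] with t ht using hqS t ht
      have h2 : W =ᶠ[𝓝 x] fun t => q t * C t := by
        filter_upwards [Icc_mem_nhds hx.1 hx.2] with t ht using hqC t ht
      have h3 := (hV' x hx).unique ((hqd.hasDerivAt.mul (hS' x)).congr_of_eventuallyEq h1)
      have h4 := (hW' x hx).unique ((hqd.hasDerivAt.mul (hC' x hx)).congr_of_eventuallyEq h2)
      rw [hqC x hxI] at h3
      rw [hqS x hxI] at h4
      -- Comparing derivatives gives `q' S = 0` and `q' C = 0`.
      have h5 : deriv q x * (S x ^ 2 + C x ^ 2) = 0 := by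
        linear_combination -S x * h3 - C x * h4
      have h6 : deriv q x = 0 := by simpa [(hpos x hxI).ne'] using h5
      rw [← h6]
      exact hqd.hasDerivAt
  have hc : q α ≠ 0 := fun h0 => by
    obtain ⟨x, hx, hne⟩ := hVne
    exact hne (by rw [hqS x hx, hqconst x hx, h0, zero_mul])
  refine ⟨⟨q α, hc, fun x hx => by rw [hqS x hx, hqconst x hx]⟩, ?_⟩
  have h2 := rightBC_iff_angle.1 hr
  have h3 : C β = R β * Real.cos (θ β) := by rw [hCdef]; exact hS.eq_cos β hβ'
  have h4 : K β * derivWithin V (Icc α β) β = W β := by rw [hWdef]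
  rw [h4, hqS β hβ', hqC β hβ', hqconst β hβ', h3, hS.eq_sin β hβ'] at h2
  have h5 : q α * R β * Real.sin (rightAngle H - θ β) = 0 := by
    rw [Real.sin_sub]
    linear_combination -h2
  simpa [hc, (hS.radius_pos β hβ').ne'] using h5

end

/-! ### The oscillation theorem -/

section

variable {α β : ℝ} {K G L : ℝ → ℝ} {h H : ENNReal}

theorem exists_isPruferSolution (hC : SmoothCoeffs K G L) (hαβ : α < β) (h : ENNReal) (r : ℝ) :
    ∃ θ R S : ℝ → ℝ, IsPruferSolution α β K G L h r θ R S := by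
  obtain ⟨θ, R, S, h1, h2, h3, h4, h5⟩ := exists_prufer_solution hC hαβ r (leftAngle h)
  exact ⟨θ, R, S, h1, h2, h3, h4, fun x hx => (h5 x hx).1, fun x hx => (h5 x hx).2.1,
    fun x hx => (h5 x hx).2.2⟩

theorem IsPruferSolution.angle_pos (hC : SmoothCoeffs K G L) {r : ℝ} {θ R S : ℝ → ℝ}
    (hS : IsPruferSolution α β K G L h r θ R S) {x : ℝ} (hx : α < x) (hxβ : x ≤ β) : 0 < θ x := by
  have := hS.angle.lt_of_le hC le_rfl hx hxβ 0 (by simpa [hS.init] using leftAngle_nonneg h)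
  simpa using this

theorem IsPruferSolution.exists_nat_of_isEigenfunction (hC : SmoothCoeffs K G L) (hαβ : α < β)
    {r : ℝ} {θ R S V : ℝ → ℝ} (hS : IsPruferSolution α β K G L h r θ R S)
    (hV : IsEigenfunction α β K G L h H r V) : ∃ j : ℕ, θ β = rightAngle H + j * Real.pi := by
  have h1 := (hS.exists_eqOn_of_isEigenfunction hC hαβ hV).2
  obtain ⟨k, hk⟩ := Real.sin_eq_zero_iff.1 h1
  have h2 := hS.angle_pos hC hαβ le_rfl
  have h3 := rightAngle_le H
  -- Here `θ β = rightAngle H - k π`, with `θ β > 0` and `rightAngle H ≤ π`.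
  have hk1 : (k : ℝ) * Real.pi < 1 * Real.pi := by linarith
  have hk2 : (k : ℝ) < 1 := lt_of_mul_lt_mul_right hk1 Real.pi_pos.le
  have hk3 : k ≤ 0 := by
    have : k < 1 := by exact_mod_cast hk2
    omega
  obtain ⟨j, hj⟩ := Int.eq_ofNat_of_zero_le (neg_nonneg.2 hk3)
  refine ⟨j, ?_⟩
  have hj' : (j : ℝ) = -(k : ℝ) := by exact_mod_cast hj.symm
  rw [hj']
  linarith

theorem sin_rightAngle_sub {t : ℝ} {j : ℕ} (ht : t = rightAngle H + j * Real.pi) :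
    Real.sin (rightAngle H - t) = 0 := by
  rw [ht, sub_add_cancel_left, Real.sin_neg, Real.sin_nat_mul_pi, neg_zero]

/-- The `p`-th eigenvalue corresponds to the terminal angle `rightAngle H + (p - 1) π`. -/
theorem exists_angle_of_isNthEigenvalue (hC : SmoothCoeffs K G L) (hαβ : α < β)
    {θ R S : ℝ → ℝ → ℝ} (hS : ∀ r, IsPruferSolution α β K G L h r (θ r) (R r) (S r))
    {p : ℕ} {r : ℝ} (hr : IsNthEigenvalue α β K G L h H p r) :
    ∃ j : ℕ, p = j + 1 ∧ θ r β = rightAngle H + j * Real.pi ∧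
      ∀ i ≤ j, ∃ s ≤ r, θ s β = rightAngle H + i * Real.pi := by
  obtain ⟨⟨V, hV⟩, hcard⟩ := hr
  obtain ⟨j, hj⟩ := (hS r).exists_nat_of_isEigenfunction hC hαβ hV
  have hmono : StrictMono fun r => θ r β := fun r s hrs =>
    (hS r).angle.lt_of_lt hC hαβ hrs (hS s).angle (by rw [(hS r).init, (hS s).init])
  have hcont : Continuous fun r => θ r β :=
    continuous_pruferAngle_param hC hαβ (fun r => (hS r).angle) fun r => (hS r).init
  have hlow : θ 0 β < rightAngle H :=
    ((hS 0).angle.lt_pi_div_two hC hαβ (by rw [(hS 0).init]; exact leftAngle_le h)).trans_le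
      (le_rightAngle H)
  have hex : ∀ i ≤ j, ∃ s ≤ r, θ s β = rightAngle H + i * Real.pi := fun i hi => by
    have h1 : (i : ℝ) * Real.pi ≤ j * Real.pi :=
      mul_le_mul_of_nonneg_right (by exact_mod_cast hi) Real.pi_pos.le
    have h2 : 0 ≤ (i : ℝ) * Real.pi := mul_nonneg (Nat.cast_nonneg i) Real.pi_pos.le
    have h3 : rightAngle H + i * Real.pi ∈ uIcc (θ 0 β) (θ r β) := by
      rw [hj]
      exact ⟨inf_le_left.trans (by linarith), le_sup_of_le_right (by linarith)⟩
    obtain ⟨s, -, hs⟩ := intermediate_value_uIcc hcont.continuousOn h3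
    refine ⟨s, hmono.le_iff_le.1 ?_, hs⟩
    simp only at hs ⊢
    rw [hs, hj]
    linarith
  refine ⟨j, ?_, hj, hex⟩
  choose! s hsr hs using hex
  -- The terminal angle increases strictly with the parameter, so the eigenvalues up to `r` are the
  -- parameters with terminal angle `rightAngle H + i π`, `0 ≤ i ≤ j`.
  have hset : {t ∈ eigenvalues α β K G L h H | t ≤ r} = s '' (Finset.range (j + 1) : Set ℕ) := by
    ext t
    constructor
    · rintro ⟨⟨V, hV⟩, htr⟩
      obtain ⟨i, hi⟩ := (hS t).exists_nat_of_isEigenfunction hC hαβ hV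
      have h1 : θ t β ≤ θ r β := hmono.monotone htr
      rw [hi, hj, add_le_add_iff_left] at h1
      have h2 : i ≤ j := by exact_mod_cast le_of_mul_le_mul_right h1 Real.pi_pos
      refine ⟨i, by simpa [Nat.lt_succ_iff] using h2, hmono.injective ?_⟩
      rw [hs i h2, hi]
    · rintro ⟨i, hi, rfl⟩
      have hi' : i ≤ j := by simpa [Nat.lt_succ_iff] using hi
      exact ⟨⟨_, ((hS (s i)).isMode hαβ (sin_rightAngle_sub (hs i hi'))).isEigenfunction hαβ⟩,
        hsr i hi'⟩
  have hinj : InjOn s (Finset.range (j + 1) : Set ℕ) := fun a ha b hb hab => by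
    have ha' : a ≤ j := by simpa [Nat.lt_succ_iff] using ha
    have hb' : b ≤ j := by simpa [Nat.lt_succ_iff] using hb
    have h1 := hs a ha'
    rw [hab, hs b hb', add_right_inj] at h1
    exact_mod_cast (mul_right_cancel₀ Real.pi_pos.ne' h1).symm
  rw [hset, hinj.encard_image, encard_coe_eq_coe_finsetCard, Finset.card_range] at hcard
  exact_mod_cast hcard.symm

/-- Zeros of `S` are points of angle `k π`. Each level is met at most once, and only `1 ≤ k ≤ j`
occur inside: when `H = ⊤`, the level `(j + 1) π` is reached only at `β`. -/
theorem IsPruferSolution.zeros (hC : SmoothCoeffs K G L) {r : ℝ} {θ R S : ℝ → ℝ}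
    (hS : IsPruferSolution α β K G L h r θ R S) {j : ℕ} (hj : θ β = rightAngle H + j * Real.pi) :
    {x ∈ Ioo α β | S x = 0}.Finite ∧ {x ∈ Ioo α β | S x = 0}.ncard ≤ j := by
  have hk : ∀ x ∈ {x ∈ Ioo α β | S x = 0}, ∃ k ∈ Icc (1 : ℤ) j, θ x = k * Real.pi := by
    rintro x ⟨hx, hx0⟩
    have hxI := Ioo_subset_Icc_self hx
    rw [hS.eq_sin x hxI, mul_eq_zero, or_iff_right (hS.radius_pos x hxI).ne'] at hx0
    obtain ⟨k, hk⟩ := Real.sin_eq_zero_iff.1 hx0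
    refine ⟨k, ⟨?_, ?_⟩, hk.symm⟩
    · have h1 := hS.angle_pos hC hx.1 hx.2.le
      rw [← hk] at h1
      have h2 : (0 : ℝ) < k := pos_of_mul_pos_left h1 Real.pi_pos.le
      have h3 : 0 < k := by exact_mod_cast h2
      omega
    · have h1 := hS.angle.lt_of_le hC hx.1.le hx.2 le_rfl k hk.le
      have h2 := rightAngle_le H
      have h3 : (k : ℝ) * Real.pi < (j + 1) * Real.pi := by linarith
      have h4 : (k : ℝ) < j + 1 := lt_of_mul_lt_mul_right h3 Real.pi_pos.le
      have h5 : k < j + 1 := by exact_mod_cast h4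
      omega
  choose! k hkmem hk using hk
  have hinj : InjOn k {x ∈ Ioo α β | S x = 0} := by
    intro x hx y hy hxy
    by_contra hne
    rcases lt_or_gt_of_ne hne with hlt | hlt
    · have := hS.angle.lt_of_le hC hx.1.1.le hlt hy.1.2.le _ (hk x hx).ge
      rw [hk y hy, hxy] at this
      exact lt_irrefl _ this
    · have := hS.angle.lt_of_le hC hy.1.1.le hlt hx.1.2.le _ (hk y hy).ge
      rw [hk x hx, hxy] at this
      exact lt_irrefl _ this
  refine ⟨Set.Finite.of_injOn hkmem hinj (finite_Icc _ _), ?_⟩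
  refine (ncard_le_ncard_of_injOn k hkmem hinj (finite_Icc _ _)).trans ?_
  rw [← Finset.coe_Icc, ncard_coe_finset, Int.card_Icc]
  omega

/-- Take one point with angle in `]i π, (i + 1) π[` for each `i ≤ j`; there `sin` has the sign `(-1)
^ i`. -/
theorem IsPruferSolution.alternates (hC : SmoothCoeffs K G L) (hαβ : α < β) {r : ℝ}
    {θ R S : ℝ → ℝ} (hS : IsPruferSolution α β K G L h r θ R S) {j : ℕ}
    (hj : θ β = rightAngle H + j * Real.pi) : Alternates α β S j := by
  have hπ := Real.pi_pos
  have hex : ∀ i ≤ j, ∃ x ∈ Ioo α β, i * Real.pi < θ x ∧ θ x < i * Real.pi + Real.pi := by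
    intro i hi
    rcases Nat.eq_zero_or_pos i with rfl | hpos
    -- The initial angle may exceed `π/4`, so for `i = 0` a point close to `α` is used.
    · have h1 : ∀ᶠ x in 𝓝[>] α, θ x < Real.pi :=
        (hS.angle.continuous.continuousAt.eventually_lt_const
          (by rw [hS.init]; linarith [leftAngle_le h])).filter_mono nhdsWithin_le_nhds
      obtain ⟨x, hx, hx'⟩ := (h1.and (Ioo_mem_nhdsGT hαβ)).exists
      refine ⟨x, hx', ?_, by simpa using hx⟩
      simpa using hS.angle_pos hC hx'.1 hx'.2.le
    · have h1 : (i : ℝ) * Real.pi ≤ j * Real.pi :=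
        mul_le_mul_of_nonneg_right (by exact_mod_cast hi) hπ.le
      have h2 : 1 * Real.pi ≤ (i : ℝ) * Real.pi :=
        mul_le_mul_of_nonneg_right (by exact_mod_cast hpos) hπ.le
      have h3 : i * Real.pi + Real.pi / 4 ∈ Ioo (θ α) (θ β) := by
        rw [hS.init, hj]
        exact ⟨by linarith [leftAngle_le h], by linarith [le_rightAngle H]⟩
      obtain ⟨x, hx, hx'⟩ := intermediate_value_Ioo hαβ.le hS.angle.continuous.continuousOn h3
      exact ⟨x, hx, by rw [hx']; linarith, by rw [hx']; linarith⟩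
  choose! t ht htl htu using hex
  refine ⟨t, 1, ht, fun i hi => ?_, fun i hi => ?_⟩
  · by_contra hle
    have h1 := htl (i + 1) hi
    have h2 := htu i hi.le
    push_cast at h1
    rcases (not_lt.1 hle).eq_or_lt with heq | hlt
    · rw [heq] at h1; linarith
    · have := hS.angle.lt_of_le hC (ht _ hi).1.le hlt (ht _ hi.le).2.le (i + 1)
        (by push_cast; exact h1.le)
      push_cast at this
      linarith
  · have hI := Ioo_subset_Icc_self (ht i hi)
    have h1 := Real.sin_pos_of_pos_of_lt_pi (x := θ (t i) - i * Real.pi)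
      (by linarith [htl i hi]) (by linarith [htu i hi])
    rw [Real.sin_sub_nat_mul_pi] at h1
    rw [hS.eq_sin _ hI, one_mul]
    have := mul_pos (hS.radius_pos _ hI) h1
    linarith

theorem Alternates.const_mul {f : ℝ → ℝ} {j : ℕ} (hf : Alternates α β f j) {c : ℝ} (hc : c ≠ 0) :
    Alternates α β (fun x => c * f x) j := by
  obtain ⟨t, ε, h1, h2, h3⟩ := hf
  refine ⟨t, ε * c⁻¹, h1, h2, fun i hi => ?_⟩
  have := h3 i hi
  field_simp
  linarith

/-- The oscillation theorem: the `p`-th eigenfunction has `p - 1` zeros in `]α, β[`, at which it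
changes sign. -/
theorem exists_mode_of_isNthEigenfunction (hC : SmoothCoeffs K G L) (hαβ : α < β) {p : ℕ}
    {V : ℝ → ℝ} (hV : IsNthEigenfunction α β K G L h H p V) :
    ∃ (r : ℝ) (W : ℝ → ℝ), IsNthEigenvalue α β K G L h H p r ∧ IsMode α β K G L h H r W ∧
      EqOn V W (Icc α β) ∧ {x ∈ Ioo α β | W x = 0}.Finite ∧
      {x ∈ Ioo α β | W x = 0}.ncard ≤ p - 1 ∧ Alternates α β W (p - 1) := by
  choose θ R S hS using exists_isPruferSolution hC hαβ h
  obtain ⟨r, hr, hV⟩ := hV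
  obtain ⟨j, rfl, hj, -⟩ := exists_angle_of_isNthEigenvalue hC hαβ hS hr
  obtain ⟨⟨c, hc, hcV⟩, hsin⟩ := (hS r).exists_eqOn_of_isEigenfunction hC hαβ hV
  refine ⟨r, fun x => c * S r x, hr, ((hS r).isMode hαβ hsin).const_mul hc, hcV, ?_⟩
  simp only [mul_eq_zero, hc, false_or, Nat.add_sub_cancel]
  exact ⟨((hS r).zeros hC hj).1, ((hS r).zeros hC hj).2,
    ((hS r).alternates hC hαβ hj).const_mul hc⟩

/-- If some `p`-th eigenvalue exists, there is a positive ground state. -/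
theorem exists_ground_state (hC : SmoothCoeffs K G L) (hαβ : α < β) {p : ℕ} {r : ℝ}
    (hr : IsNthEigenvalue α β K G L h H p r) :
    ∃ (r₀ : ℝ) (U : ℝ → ℝ), IsMode α β K G L h H r₀ U ∧ (∀ x ∈ Ioo α β, 0 < U x) ∧
      ∀ q s, IsNthEigenvalue α β K G L h H q s → r₀ ≤ s ∧ (2 ≤ q → r₀ < s) := by
  choose θ R S hS using exists_isPruferSolution hC hαβ h
  obtain ⟨j, -, -, hex⟩ := exists_angle_of_isNthEigenvalue hC hαβ hS hr
  obtain ⟨r₀, -, hr₀⟩ := hex 0 (Nat.zero_le j)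
  refine ⟨r₀, S r₀, (hS r₀).isMode hαβ (sin_rightAngle_sub hr₀), fun x hx => ?_, fun q s hs => ?_⟩
  · have hxI := Ioo_subset_Icc_self hx
    rw [(hS r₀).eq_sin x hxI]
    refine mul_pos ((hS r₀).radius_pos x hxI) (Real.sin_pos_of_pos_of_lt_pi
      ((hS r₀).angle_pos hC hx.1 hx.2.le) ?_)
    -- An angle reaching `π` inside would end beyond `π ≥ rightAngle H`.
    by_contra hge
    have h1 := (hS r₀).angle.lt_of_le hC hx.1.le hx.2 le_rfl 1 (by simpa using hge)
    have h2 := rightAngle_le H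
    simp at h1 hr₀
    linarith
  · have hmono : StrictMono fun r => θ r β := fun r s hrs =>
      (hS r).angle.lt_of_lt hC hαβ hrs (hS s).angle (by rw [(hS r).init, (hS s).init])
    obtain ⟨i, hq, hi, -⟩ := exists_angle_of_isNthEigenvalue hC hαβ hS hs
    have hπ := Real.pi_pos
    have h1 : 0 ≤ (i : ℝ) * Real.pi := by positivity
    simp only [Nat.cast_zero, zero_mul, add_zero] at hr₀
    refine ⟨hmono.le_iff_le.1 ?_, fun hq2 => hmono.lt_iff_lt.1 ?_⟩
    · rw [hr₀, hi]; linarith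
    · have h2 : (0 : ℝ) < i := by
        have : 0 < i := by omega
        exact_mod_cast this
      have := mul_pos h2 hπ
      rw [hr₀, hi]; linarith

theorem IsNthEigenvalue.lt_of_lt {p q : ℕ} {r s : ℝ} (hr : IsNthEigenvalue α β K G L h H p r)
    (hs : IsNthEigenvalue α β K G L h H q s) (hpq : p < q) : r < s := by
  by_contra hle
  have h1 : {t ∈ eigenvalues α β K G L h H | t ≤ s} ⊆ {t ∈ eigenvalues α β K G L h H | t ≤ r} :=
    fun t ht => ⟨ht.1, ht.2.trans (not_lt.1 hle)⟩
  have h2 := encard_le_encard h1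
  rw [hr.2, hs.2] at h2
  have : q ≤ p := by exact_mod_cast h2
  omega

end

/-! ### The shifted operator -/

/-- `Y` satisfies the boundary conditions, and `κ Z = (T - r₀) Y` near `[α, β]`, where
`T Y = (L Y - (K Y')') / G`. -/
structure IsShift (α β : ℝ) (K G L : ℝ → ℝ) (h H : ENNReal) (r₀ κ : ℝ) (Y Z : ℝ → ℝ) : Prop where
  contDiff_left : ContDiff ℝ ∞ Y
  contDiff_right : ContDiff ℝ ∞ Z
  eqn : ∀ x ∈ Icc α β, ∀ᶠ t in 𝓝 x,
    deriv (fun t => K t * deriv Y t) t = (L t - r₀ * G t) * Y t - κ * G t * Z t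
  left : Y α * Real.cos (leftAngle h) = K α * deriv Y α * Real.sin (leftAngle h)
  right : Y β * Real.cos (rightAngle H) = K β * deriv Y β * Real.sin (rightAngle H)

/-- A linear combination of the functions `V p`. -/
noncomputable def comb (s : Finset ℕ) (V : ℕ → ℝ → ℝ) (B : ℕ → ℝ) (x : ℝ) : ℝ := ∑ p ∈ s, B p * V p x

section

variable {α β : ℝ} {K G L : ℝ → ℝ} {h H : ENNReal} {r₀ κ : ℝ} {Y Z U : ℝ → ℝ}
  {s : Finset ℕ} {V : ℕ → ℝ → ℝ} {ρ : ℕ → ℝ}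

theorem wronskian_eq_zero_of_angle {v w v' w' θ : ℝ} (h1 : v * Real.cos θ = w * Real.sin θ)
    (h2 : v' * Real.cos θ = w' * Real.sin θ) : w * v' - v * w' = 0 := by
  linear_combination (-(w * v' - v * w')) * Real.sin_sq_add_cos_sq θ
    + (w' * Real.cos θ + Real.sin θ * v') * (-h1) + (w * Real.cos θ + v * Real.sin θ) * h2

/-- For Robin endpoints: a zero there is automatically multiple, so a mode cannot vanish there. -/
theorem deriv_eq_zero_of_angle {k v w θ : ℝ} (h1 : v * Real.cos θ = k * w * Real.sin θ)
    (hk : 0 < k) (hθ : 0 < Real.sin θ) (hv : v = 0) : w = 0 := by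
  rw [hv, zero_mul] at h1
  simpa [hk.ne', hθ.ne'] using h1.symm

theorem contDiff_comb (hV : ∀ p ∈ s, ContDiff ℝ ∞ (V p)) (B : ℕ → ℝ) :
    ContDiff ℝ ∞ (comb s V B) :=
  ContDiff.sum fun p hp => contDiff_const.mul (hV p hp)

theorem deriv_comb (hV : ∀ p ∈ s, ContDiff ℝ ∞ (V p)) (B : ℕ → ℝ) (x : ℝ) :
    deriv (comb s V B) x = comb s (fun p => deriv (V p)) B x := by
  have : comb s V B = fun x => ∑ p ∈ s, B p * V p x := rfl
  rw [this, deriv_fun_sum fun p hp =>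
    ((contDiff_const.mul (hV p hp)).differentiable (by simp)).differentiableAt]
  exact Finset.sum_congr rfl fun p _ => deriv_const_mul_field _

/-- `T` multiplies each mode by `ρ p`, so the shift only rescales coefficients; the free factor `κ`
serves to normalise iterates. -/
theorem isShift_comb (hC : SmoothCoeffs K G L) (hV : ∀ p ∈ s, IsMode α β K G L h H (ρ p) (V p))
    {B B' : ℕ → ℝ} (hB : ∀ p ∈ s, κ * B' p = (ρ p - r₀) * B p) :
    IsShift α β K G L h H r₀ κ (comb s V B) (comb s V B') := by
  have hVs : ∀ p ∈ s, ContDiff ℝ ∞ (V p) := fun p hp => (hV p hp).contDiff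
  refine ⟨contDiff_comb hVs B, contDiff_comb hVs B', fun x hx => ?_, ?_, ?_⟩
  · have h1 : ∀ᶠ t in 𝓝 x, ∀ p ∈ s,
        deriv (fun t => K t * deriv (V p) t) t = (L t - ρ p * G t) * V p t :=
      (Filter.eventually_all_finset s).2 fun p hp => (hV p hp).ode x hx
    filter_upwards [h1] with t ht
    have h2 : (fun t => K t * deriv (comb s V B) t) =
        fun t => ∑ p ∈ s, B p * (K t * deriv (V p) t) := by
      ext t
      rw [deriv_comb hVs, comb, Finset.mul_sum]
      exact Finset.sum_congr rfl fun p _ => by ring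
    rw [h2, deriv_fun_sum fun p hp => ((contDiff_const.mul (hC.contDiff_K.mul
      (contDiff_deriv (hVs p hp)))).differentiable (by simp)).differentiableAt, comb, comb,
      Finset.mul_sum, Finset.mul_sum, ← Finset.sum_sub_distrib]
    refine Finset.sum_congr rfl fun p hp => ?_
    rw [deriv_const_mul_field, ht p hp]
    linear_combination (G t * V p t) * hB p hp
  · rw [deriv_comb hVs, comb, comb, Finset.mul_sum, Finset.sum_mul, Finset.sum_mul]
    exact Finset.sum_congr rfl fun p hp => by linear_combination B p * (hV p hp).left
  · rw [deriv_comb hVs, comb, comb, Finset.mul_sum, Finset.sum_mul, Finset.sum_mul]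
    exact Finset.sum_congr rfl fun p hp => by linear_combination B p * (hV p hp).right

/-- `κ G Z` is a second order differential expression in `Y`, so at most two orders are lost, and `κ
G` has no zero. -/
theorem IsShift.vanishesTo (hC : SmoothCoeffs K G L) (hκ : κ ≠ 0)
    (hYZ : IsShift α β K G L h H r₀ κ Y Z) {x : ℝ} (hx : x ∈ Icc α β) {k : ℕ}
    (hY : VanishesTo k Y x) : VanishesTo (k - 2) Z x := by
  have hYs := hYZ.contDiff_left
  have hZs := hYZ.contDiff_right
  have hK := hC.contDiff_K
  have hc : ContDiff ℝ ∞ fun t => L t - r₀ * G t :=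
    hC.contDiff_L.sub (contDiff_const.mul hC.contDiff_G)
  have hKY : ContDiff ℝ ∞ fun t => K t * deriv Y t := hK.mul (contDiff_deriv hYs)
  have h1 : VanishesTo (k - 2) (deriv fun t => K t * deriv Y t) x :=
    (hY.deriv.mul_left hK (contDiff_deriv hYs)).deriv
  have h2 : VanishesTo (k - 2) (fun t => (L t - r₀ * G t) * Y t) x :=
    (hY.mono (Nat.sub_le k 2)).mul_left hc hYs
  have h3 := h2.add (h1.mul_left (contDiff_const (c := (-1 : ℝ))) (contDiff_deriv hKY))
    (hc.mul hYs) (contDiff_const.mul (contDiff_deriv hKY))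
  refine VanishesTo.of_mul_left (u := fun t => κ * G t) (h3.congr ?_)
    (mul_ne_zero hκ (hC.G_pos x).ne') (contDiff_const.mul hC.contDiff_G) hZs
  filter_upwards [hYZ.eqn x hx] with t ht
  linear_combination -ht

/-- A linear combination of modes with distinct parameters which is flat at a point is trivial. -/
theorem eq_zero_of_flat (hC : SmoothCoeffs K G L)
    (hV : ∀ p ∈ s, IsMode α β K G L h H (ρ p) (V p)) (hρ : Set.InjOn ρ s) {x : ℝ}
    (hx : x ∈ Icc α β) {B : ℕ → ℝ} (hflat : ∀ k, VanishesTo k (comb s V B) x) :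
    ∀ p ∈ s, B p = 0 := by
  induction s using Finset.induction_on generalizing B with
  | empty => simp
  | insert a s ha ih =>
    -- `T - ρ a` kills the mode `a` and preserves flatness.
    have hshift := isShift_comb (r₀ := ρ a) (κ := 1) hC hV
      (B := B) (B' := fun p => (ρ p - ρ a) * B p) fun p _ => one_mul _
    have h1 : comb (insert a s) V (fun p => (ρ p - ρ a) * B p) =
        comb s V fun p => (ρ p - ρ a) * B p := by
      ext x; simp [comb, Finset.sum_insert ha]
    rw [h1] at hshift
    have h2 := ih (fun p hp => hV p (Finset.mem_insert_of_mem hp))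
      (hρ.mono (by simp)) (B := fun p => (ρ p - ρ a) * B p)
      fun k => hshift.vanishesTo hC one_ne_zero hx (hflat (k + 2))
    have h3 : ∀ p ∈ s, B p = 0 := fun p hp => by
      refine (mul_eq_zero.1 (h2 p hp)).resolve_left fun h0 => ha ?_
      have := hρ (by simp [hp]) (by simp) (sub_eq_zero.1 h0)
      rwa [← this]
    have h4 : comb (insert a s) V B = fun t => B a * V a t := by
      ext t
      rw [comb, Finset.sum_insert ha, Finset.sum_eq_zero fun p hp => by rw [h3 p hp, zero_mul],
        add_zero]
    have h5 : B a = 0 := by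
      by_contra hne
      have hVa := hV a (Finset.mem_insert_self a s)
      have h6 := hflat 2
      rw [h4] at h6
      have h7 := h6.of_mul_left (u := fun _ => B a) hne contDiff_const hVa.contDiff
      rw [vanishesTo_succ, vanishesTo_one] at h7
      rcases hVa.ne_zero x hx with h8 | h8
      · exact h8 h7.1
      · exact h8 h7.2
    intro p hp
    rcases Finset.mem_insert.1 hp with rfl | hp
    · exact h5
    · exact h3 p hp

theorem exists_iteratedDeriv_comb_ne_zero (hC : SmoothCoeffs K G L)
    (hV : ∀ p ∈ s, IsMode α β K G L h H (ρ p) (V p)) (hρ : Set.InjOn ρ s) {B : ℕ → ℝ}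
    (hB : ∃ p ∈ s, B p ≠ 0) : ∀ x ∈ Icc α β, ∃ k, iteratedDeriv k (comb s V B) x ≠ 0 := by
  intro x hx
  by_contra! hc
  obtain ⟨p, hp, hne⟩ := hB
  exact hne (eq_zero_of_flat hC hV hρ hx (fun k q _ => hc q) p hp)

/-- The weighted Wronskian `K (Y' U - Y U')`. -/
noncomputable def wronskian (K Y U : ℝ → ℝ) (x : ℝ) : ℝ :=
  K x * deriv Y x * U x - Y x * (K x * deriv U x)

/-- The terms in `L` and `r₀` cancel because `U` solves the equation with the same `r₀`. -/
theorem IsShift.hasDerivAt_wronskian (hC : SmoothCoeffs K G L)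
    (hYZ : IsShift α β K G L h H r₀ κ Y Z) (hU : IsMode α β K G L h H r₀ U) {x : ℝ}
    (hx : x ∈ Icc α β) : HasDerivAt (wronskian K Y U) (-(κ * G x * U x * Z x)) x := by
  have hY' := (hYZ.contDiff_left.differentiable (by simp) x).hasDerivAt
  have hU' := (hU.contDiff.differentiable (by simp) x).hasDerivAt
  have hKY := ((hC.contDiff_K.mul (contDiff_deriv hYZ.contDiff_left)).differentiable
    (by simp) x).hasDerivAt
  have hKU := ((hC.contDiff_K.mul (contDiff_deriv hU.contDiff)).differentiable
    (by simp) x).hasDerivAt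
  refine ((hKY.mul hU').sub (hY'.mul hKU)).congr_deriv ?_
  rw [(hYZ.eqn x hx).self_of_nhds, (hU.ode x hx).self_of_nhds]
  ring

theorem IsShift.wronskian_left (hYZ : IsShift α β K G L h H r₀ κ Y Z)
    (hU : IsMode α β K G L h H r₀ U) : wronskian K Y U α = 0 :=
  wronskian_eq_zero_of_angle hYZ.left hU.left

theorem IsShift.wronskian_right (hYZ : IsShift α β K G L h H r₀ κ Y Z)
    (hU : IsMode α β K G L h H r₀ U) : wronskian K Y U β = 0 :=
  wronskian_eq_zero_of_angle hYZ.right hU.right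

theorem hasDerivAt_div_wronskian (hC : SmoothCoeffs K G L) (hY : ContDiff ℝ ∞ Y)
    (hU : ContDiff ℝ ∞ U) {x : ℝ} (hx : U x ≠ 0) :
    HasDerivAt (fun t => Y t / U t) (wronskian K Y U x / (K x * U x ^ 2)) x := by
  refine ((hY.differentiable (by simp) x).hasDerivAt.div
    (hU.differentiable (by simp) x).hasDerivAt hx).congr_deriv ?_
  have := (hC.K_pos x).ne'
  unfold wronskian
  field_simp

/-- The shifted operator does not decrease the number of sign changes. -/
theorem IsShift.alternates (hC : SmoothCoeffs K G L) (hαβ : α < β) (hκ : 0 < κ)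
    (hYZ : IsShift α β K G L h H r₀ κ Y Z) (hU : IsMode α β K G L h H r₀ U)
    (hUpos : ∀ x ∈ Ioo α β, 0 < U x) {j : ℕ} (hj : 1 ≤ j) (hY : Alternates α β Y j) :
    Alternates α β Z j := by
  obtain ⟨t, ε, ht, hlt, hsign⟩ := hY
  -- `Y / U` changes sign over the interval, so the mean value theorem fixes the sign of its
  -- derivative, hence of the Wronskian, at some point.
  have h1 : ∀ i < j, ∃ x ∈ Ioo (t i) (t (i + 1)), 0 < ε * (-1) ^ (i + 1) * wronskian K Y U x := by
    intro i hi
    have hsub : ∀ x ∈ Icc (t i) (t (i + 1)), x ∈ Ioo α β := fun x hx =>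
      ⟨(ht i hi.le).1.trans_le hx.1, hx.2.trans_lt (ht (i + 1) hi).2⟩
    have hder := fun x (hx : x ∈ Icc (t i) (t (i + 1))) =>
      hasDerivAt_div_wronskian hC hYZ.contDiff_left hU.contDiff (hUpos x (hsub x hx)).ne'
    obtain ⟨x, hx, hx'⟩ := exists_hasDerivAt_eq_slope (fun t => Y t / U t) _ (hlt i hi)
      (fun x hx => (hder x hx).continuousAt.continuousWithinAt)
      fun x hx => hder x (Ioo_subset_Icc_self hx)
    refine ⟨x, hx, ?_⟩
    have hKU : 0 < K x * U x ^ 2 :=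
      mul_pos (hC.K_pos x) (pow_pos (hUpos x (hsub x (Ioo_subset_Icc_self hx))) 2)
    rw [div_eq_iff hKU.ne'] at hx'
    have h2 : 0 < ε * (-1) ^ i * Y (t i) / U (t i) := div_pos (hsign i hi.le) (hUpos _ (ht i hi.le))
    have h3 : 0 < ε * (-1) ^ (i + 1) * Y (t (i + 1)) / U (t (i + 1)) :=
      div_pos (hsign (i + 1) hi) (hUpos _ (ht (i + 1) hi))
    have h4 : 0 < (ε * (-1) ^ (i + 1) * Y (t (i + 1)) / U (t (i + 1)) +
        ε * (-1) ^ i * Y (t i) / U (t i)) / (t (i + 1) - t i) * (K x * U x ^ 2) :=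
      mul_pos (div_pos (add_pos h3 h2) (sub_pos.2 (hlt i hi))) hKU
    rw [hx']
    convert h4 using 1
    rw [pow_succ]
    ring
  choose! x hx hxs using h1
  -- the points `x i`, completed by the two endpoints
  obtain ⟨w, hw⟩ : ∃ w : ℕ → ℝ, w = fun i => if i = 0 then α else if i ≤ j then x (i - 1) else β :=
    ⟨_, rfl⟩
  have hw0 : w 0 = α := by simp [hw]
  have hwj : w (j + 1) = β := by simp [hw]
  have hwi : ∀ i < j, w (i + 1) = x i := fun i hi => by simp [hw, Nat.succ_le_iff.2 hi]
  have hxα : ∀ i < j, α < x i := fun i hi => (ht i hi.le).1.trans (hx i hi).1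
  have hxβ : ∀ i < j, x i < β := fun i hi => (hx i hi).2.trans (ht (i + 1) hi).2
  have hwlt : ∀ i ≤ j, w i < w (i + 1) := by
    intro i hi
    rcases Nat.eq_zero_or_pos i with rfl | hpos
    · rw [hw0, hwi 0 (by omega)]; exact hxα 0 (by omega)
    · obtain ⟨i, rfl⟩ := Nat.exists_eq_succ_of_ne_zero hpos.ne'
      rw [Nat.succ_eq_add_one, hwi i hi]
      rcases hi.eq_or_lt with heq | hlt
      · have : i + 1 + 1 = j + 1 := by omega
        rw [this, hwj]; exact hxβ i (by omega)
      · rw [hwi (i + 1) hlt]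
        exact (hx i (by omega)).2.trans (hx (i + 1) hlt).1
  have hwI : ∀ i ≤ j + 1, w i ∈ Icc α β := by
    intro i hi
    rcases Nat.eq_zero_or_pos i with rfl | hpos
    · rw [hw0]; exact ⟨le_rfl, hαβ.le⟩
    · obtain ⟨i, rfl⟩ := Nat.exists_eq_succ_of_ne_zero hpos.ne'
      rcases hi.eq_or_lt with heq | hlt
      · rw [heq, hwj]; exact ⟨hαβ.le, le_rfl⟩
      · have hij : i < j := by omega
        rw [Nat.succ_eq_add_one, hwi i hij]
        exact ⟨(hxα i hij).le, (hxβ i hij).le⟩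
  have hwpos : ∀ i, 1 ≤ i → i ≤ j → 0 < ε * (-1) ^ i * wronskian K Y U (w i) := by
    intro i h1 h2
    obtain ⟨i, rfl⟩ := Nat.exists_eq_succ_of_ne_zero (Nat.one_le_iff_ne_zero.1 h1)
    rw [Nat.succ_eq_add_one, hwi i h2]
    exact hxs i h2
  have hwnonneg : ∀ i ≤ j + 1, 0 ≤ ε * (-1) ^ i * wronskian K Y U (w i) := by
    intro i hi
    rcases Nat.eq_zero_or_pos i with rfl | hpos
    · rw [hw0, hYZ.wronskian_left hU, mul_zero]
    · rcases hi.eq_or_lt with heq | hlt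
      · rw [heq, hwj, hYZ.wronskian_right hU, mul_zero]
      · exact (hwpos i hpos (by omega)).le
  -- The `j` inner points and the two endpoints bound `j + 1` intervals, on each of which the mean
  -- slope of the Wronskian has a strict sign; that slope is a value of `-κ G U Z`.
  have h2 : ∀ i ≤ j, ∃ y ∈ Ioo (w i) (w (i + 1)), 0 < ε * (-1) ^ i * Z y := by
    intro i hi
    have hsub : Icc (w i) (w (i + 1)) ⊆ Icc α β :=
      Icc_subset_Icc (hwI i (by omega)).1 (hwI (i + 1) (by omega)).2
    have hder := fun x (hx : x ∈ Icc (w i) (w (i + 1))) =>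
      hYZ.hasDerivAt_wronskian hC hU (hsub hx)
    obtain ⟨y, hy, hy'⟩ := exists_hasDerivAt_eq_slope (wronskian K Y U) _ (hwlt i hi)
      (fun x hx => (hder x hx).continuousAt.continuousWithinAt)
      fun x hx => hder x (Ioo_subset_Icc_self hx)
    refine ⟨y, hy, ?_⟩
    have hyI : y ∈ Ioo α β :=
      ⟨(hwI i (by omega)).1.trans_lt hy.1, hy.2.trans_le (hwI (i + 1) (by omega)).2⟩
    have hpos : 0 < κ * G y * U y := mul_pos (mul_pos hκ (hC.G_pos y)) (hUpos y hyI)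
    -- As `j ≥ 1`, `w i` and `w (i + 1)` are not both endpoints of `[α, β]`, so one term is strict.
    have h3 : 0 < ε * (-1) ^ (i + 1) * wronskian K Y U (w (i + 1)) +
        ε * (-1) ^ i * wronskian K Y U (w i) := by
      rcases Nat.eq_zero_or_pos i with h0 | h0
      · exact add_pos_of_pos_of_nonneg (hwpos (i + 1) (by omega) (by omega))
          (hwnonneg i (by omega))
      · exact add_pos_of_nonneg_of_pos (hwnonneg (i + 1) (by omega)) (hwpos i h0 hi)
    rw [eq_div_iff (sub_pos.2 (hwlt i hi)).ne'] at hy'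
    have h4 : 0 < (κ * G y * U y) * (w (i + 1) - w i) := mul_pos hpos (sub_pos.2 (hwlt i hi))
    refine pos_of_mul_pos_right (b := ε * (-1) ^ i * Z y)
      (a := (κ * G y * U y) * (w (i + 1) - w i)) ?_ h4.le
    rw [pow_succ] at h3
    have h5 : ε * (-1) ^ i * (κ * G y * U y * Z y * (w (i + 1) - w i)) =
        -(ε * (-1) ^ i) * (wronskian K Y U (w (i + 1)) - wronskian K Y U (w i)) := by
      rw [← hy']; ring
    linarith
  choose! y hy hys using h2
  exact ⟨y, ε, fun i hi => ⟨(hwI i (by omega)).1.trans_lt (hy i hi).1,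
    (hy i hi).2.trans_le (hwI (i + 1) (by omega)).2⟩,
    fun i hi => (hy i hi.le).2.trans (hy (i + 1) hi).1, hys⟩

end

/-! ### Counting zeros with multiplicities -/

/-- Points between consecutive elements of `P` lie outside `P`, so discarding `P` costs nothing in
the count, and the new points are never confused with the old ones. -/
theorem exists_finset_between {Q : ℝ → Prop} (P : Finset ℝ)
    (hP : ∀ x ∈ P, ∀ y ∈ P, x < y → ∃ z ∈ Ioo x y, Q z) :
    ∃ T : Finset ℝ, Disjoint T P ∧ P.card ≤ T.card + 1 ∧
      ∀ z ∈ T, Q z ∧ ∃ x ∈ P, ∃ y ∈ P, z ∈ Ioo x y := by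
  choose! z hz hQ using hP
  set t := ((P ×ˢ P).filter fun q => q.1 < q.2).image fun q => z q.1 q.2
  refine ⟨t \ P, Finset.sdiff_disjoint, Finset.card_le_sdiff_of_interleaved
    fun x hx y hy hxy _ => ⟨z x y, ?_, hz x hx y hy hxy⟩, fun w hw => ?_⟩
  · exact Finset.mem_image.2 ⟨(x, y), by simp [hx, hy, hxy], rfl⟩
  · obtain ⟨⟨x, y⟩, hq, rfl⟩ := Finset.mem_image.1 (Finset.mem_sdiff.1 hw).1
    simp only [Finset.mem_filter, Finset.mem_product] at hq
    exact ⟨hQ x hq.1.1 y hq.1.2 hq.2, x, hq.1.1, y, hq.1.2, hz x hq.1.1 y hq.1.2 hq.2⟩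

section

variable {α β : ℝ} {K G L : ℝ → ℝ} {h H : ENNReal} {r₀ κ : ℝ} {Y Z U : ℝ → ℝ}

theorem zeroMultiplicity_eq (hαβ : α < β) {f g : ℝ → ℝ} (hg : ContDiff ℝ ∞ g)
    (hfg : EqOn f g (Icc α β)) {x : ℝ} (hx : x ∈ Icc α β) :
    zeroMultiplicity α β f x = vanishingOrder g x := by
  have h1 : ∀ p, iteratedDerivWithin p f (Icc α β) x = iteratedDeriv p g x := fun p => by
    rw [iteratedDerivWithin_congr hfg hx]
    exact iteratedDerivWithin_eq_iteratedDeriv (uniqueDiffOn_Icc hαβ)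
      (contDiff_infty.1 hg p).contDiffAt hx
  simp only [zeroMultiplicity, vanishingOrder, h1]

theorem vanishingOrder_eq_zero {f : ℝ → ℝ} {x : ℝ} (hx : f x ≠ 0) : vanishingOrder f x = 0 :=
  Nat.sInf_eq_zero.2 (Or.inl (by simpa using hx))

theorem one_le_vanishingOrder {f : ℝ → ℝ} {x : ℝ} (hfin : ∃ p, iteratedDeriv p f x ≠ 0)
    (hx : f x = 0) : 1 ≤ vanishingOrder f x :=
  (vanishesTo_one.2 hx).le_vanishingOrder hfin

theorem vanishingOrder_eq_one {f : ℝ → ℝ} {x : ℝ} (hx : f x = 0) (hx' : deriv f x ≠ 0) :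
    vanishingOrder f x = 1 := by
  have hne : iteratedDeriv 1 f x ≠ 0 := by rwa [iteratedDeriv_one]
  exact le_antisymm (Nat.sInf_le (s := {p : ℕ | iteratedDeriv p f x ≠ 0}) hne)
    (one_le_vanishingOrder ⟨1, hne⟩ hx)

theorem Nm_eq_sum (hαβ : α < β) {f : ℝ → ℝ} (hf : ContDiff ℝ ∞ f)
    (hfin : (interiorZeros α β f).Finite) :
    Nm α β f = ((∑ x ∈ hfin.toFinset, vanishingOrder f x : ℕ) : ℚ) := by
  rw [Nm, finsum_mem_eq_finite_toFinset_sum _ hfin]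
  push_cast
  refine Finset.sum_congr rfl fun x hx => ?_
  rw [zeroMultiplicity_eq hαβ hf (fun _ _ => rfl)
    (Ioo_subset_Icc_self ((hfin.mem_toFinset.1 hx).1))]

theorem Nm_congr {f g : ℝ → ℝ} (hfg : EqOn f g (Icc α β)) : Nm α β f = Nm α β g := by
  have h1 : interiorZeros α β f = interiorZeros α β g := by
    ext x
    refine and_congr_right fun hx => ?_
    rw [hfg (Ioo_subset_Icc_self hx)]
  rw [Nm, Nm, h1]
  refine finsum_mem_congr rfl fun x hx => ?_
  simp only [zeroMultiplicity, iteratedDerivWithin_congr hfg (Ioo_subset_Icc_self hx.1)]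

theorem Nv_congr {f g : ℝ → ℝ} (hfg : EqOn f g (Icc α β)) : Nv α β f = Nv α β g := by
  have h1 : interiorZeros α β f = interiorZeros α β g := by
    ext x
    refine and_congr_right fun hx => ?_
    rw [hfg (Ioo_subset_Icc_self hx)]
  rw [Nv, Nv, h1]
  refine finsum_mem_congr rfl fun x hx => ?_
  simp only [zeroMultiplicity, iteratedDerivWithin_congr hfg (Ioo_subset_Icc_self hx.1)]

theorem NmBar_congr (hαβ : α < β) {f g : ℝ → ℝ} (hfg : EqOn f g (Icc α β)) :
    NmBar α β h H f = NmBar α β h H g := by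
  simp only [NmBar, Nm_congr hfg, reducedMultiplicity, zeroMultiplicity,
    iteratedDerivWithin_congr hfg (left_mem_Icc.2 hαβ.le),
    iteratedDerivWithin_congr hfg (right_mem_Icc.2 hαβ.le)]

theorem interiorZeros_finite {f : ℝ → ℝ} (hf : ContDiff ℝ ∞ f)
    (hfin : ∀ x ∈ Icc α β, ∃ p, iteratedDeriv p f x ≠ 0) : (interiorZeros α β f).Finite :=
  (finite_zeros_of_finite_order hf hfin).subset fun _ hx => ⟨Ioo_subset_Icc_self hx.1, hx.2⟩

/-- The endpoint `e` as a finset, if it carries a Robin condition and a zero of `f`. -/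
noncomputable def robinZero (c : ENNReal) (f : ℝ → ℝ) (e : ℝ) : Finset ℝ :=
  open Classical in if c ≠ ⊤ ∧ f e = 0 then {e} else ∅

theorem mem_robinZero {c : ENNReal} {f : ℝ → ℝ} {e x : ℝ} :
    x ∈ robinZero c f e ↔ x = e ∧ c ≠ ⊤ ∧ f e = 0 := by
  unfold robinZero
  split_ifs with h1
  · simp [h1]
  · simp only [Finset.notMem_empty, false_iff]
    exact fun h2 => h1 h2.2

/-- Two lost orders are one unit of half multiplicity, lost only where `Y` vanishes.
`IsShift.sum_order_le` recovers this unit in the interior. -/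
theorem IsShift.reducedMultiplicity_le (hC : SmoothCoeffs K G L) (hαβ : α < β) (hκ : κ ≠ 0)
    (hYZ : IsShift α β K G L h H r₀ κ Y Z)
    (hZ : ∀ x ∈ Icc α β, ∃ p, iteratedDeriv p Z x ≠ 0) {e : ℝ} (he : e ∈ Icc α β) (c : ENNReal) :
    reducedMultiplicity α β c Y e ≤ reducedMultiplicity α β c Z e + ((robinZero c Y e).card : ℚ) := by
  unfold reducedMultiplicity
  split_ifs with hc
  · simp
  · rw [zeroMultiplicity_eq hαβ hYZ.contDiff_left (fun _ _ => rfl) he,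
      zeroMultiplicity_eq hαβ hYZ.contDiff_right (fun _ _ => rfl) he]
    by_cases h0 : Y e = 0
    · have h1 := (hYZ.vanishesTo hC hκ he (vanishesTo_vanishingOrder Y e)).le_vanishingOrder (hZ e he)
      have h2 : (robinZero c Y e).card = 1 := by
        rw [robinZero, if_pos ⟨hc, h0⟩, Finset.card_singleton]
      have h3 : (vanishingOrder Y e : ℚ) ≤ vanishingOrder Z e + 2 := by
        exact_mod_cast Nat.sub_le_iff_le_add.1 h1
      rw [h2]
      push_cast
      linarith
    · rw [vanishingOrder_eq_zero h0]
      simp only [Nat.cast_zero, zero_div]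
      positivity

/-- Two applications of Rolle's theorem to `Y / U` and to the Wronskian of `Y` and `U`. -/
theorem IsShift.sum_order_le (hC : SmoothCoeffs K G L) (hαβ : α < β) (hκ : κ ≠ 0)
    (hYZ : IsShift α β K G L h H r₀ κ Y Z) (hU : IsMode α β K G L h H r₀ U)
    (hUpos : ∀ x ∈ Ioo α β, 0 < U x)
    (hY : ∀ x ∈ Icc α β, ∃ p, iteratedDeriv p Y x ≠ 0)
    (hZ : ∀ x ∈ Icc α β, ∃ p, iteratedDeriv p Z x ≠ 0)
    (hYf : (interiorZeros α β Y).Finite) (hZf : (interiorZeros α β Z).Finite) :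
    ∑ x ∈ hYf.toFinset, vanishingOrder Y x + (robinZero h Y α).card + (robinZero H Y β).card ≤
      ∑ x ∈ hZf.toFinset, vanishingOrder Z x := by
  have hα' : α ∈ Icc α β := left_mem_Icc.2 hαβ.le
  have hβ' : β ∈ Icc α β := right_mem_Icc.2 hαβ.le
  set ZY := hYf.toFinset
  set ZZ := hZf.toFinset
  have hZY : ∀ x ∈ ZY, x ∈ Ioo α β ∧ Y x = 0 := fun x hx => hYf.mem_toFinset.1 hx
  -- zeros of `Y / U`
  set P₁ := ZY ∪ robinZero h Y α ∪ robinZero H Y β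
  have hP₁ : ∀ x ∈ P₁, x ∈ Icc α β ∧ Y x = 0 ∧ U x ≠ 0 := by
    intro x hx
    simp only [P₁, Finset.mem_union, mem_robinZero] at hx
    rcases hx with (hx | ⟨rfl, hh, hx⟩) | ⟨rfl, hh, hx⟩
    · exact ⟨Ioo_subset_Icc_self (hZY x hx).1, (hZY x hx).2, (hUpos x (hZY x hx).1).ne'⟩
    -- At a Robin endpoint `U` cannot vanish, so `Y / U` is regular there and Rolle's theorem may
    -- use this zero.
    · refine ⟨hα', hx, fun h0 => ?_⟩
      exact (hU.ne_zero _ hα').elim (· h0)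
        (· (deriv_eq_zero_of_angle hU.left (hC.K_pos _) (sin_leftAngle_pos hh) h0))
    · refine ⟨hβ', hx, fun h0 => ?_⟩
      exact (hU.ne_zero _ hβ').elim (· h0)
        (· (deriv_eq_zero_of_angle hU.right (hC.K_pos _) (sin_rightAngle_pos hh) h0))
  have hP₁card : P₁.card = ZY.card + (robinZero h Y α).card + (robinZero H Y β).card := by
    rw [Finset.card_union_of_disjoint, Finset.card_union_of_disjoint]
    · refine Finset.disjoint_left.2 fun x hx hx' => ?_
      rw [mem_robinZero] at hx'
      exact (hZY x hx).1.1.ne' hx'.1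
    · refine Finset.disjoint_left.2 fun x hx hx' => ?_
      rw [mem_robinZero] at hx'
      rcases Finset.mem_union.1 hx with hx | hx
      · exact (hZY x hx).1.2.ne hx'.1
      · rw [mem_robinZero] at hx
        exact hαβ.ne (hx.1.symm.trans hx'.1)
  obtain ⟨T₁, hT₁d, hT₁c, hT₁⟩ := exists_finset_between (Q := fun z => wronskian K Y U z = 0) P₁
    (fun x hx y hy hxy => by
      have hUne : ∀ t ∈ Icc x y, U t ≠ 0 := fun t ht => by
        rcases ht.1.eq_or_lt with rfl | h1
        · exact (hP₁ _ hx).2.2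
        · rcases ht.2.eq_or_lt with rfl | h2
          · exact (hP₁ _ hy).2.2
          · exact (hUpos t ⟨(hP₁ x hx).1.1.trans_lt h1, h2.trans_le (hP₁ y hy).1.2⟩).ne'
      have hder := fun t (ht : t ∈ Icc x y) =>
        hasDerivAt_div_wronskian hC hYZ.contDiff_left hU.contDiff (hUne t ht)
      obtain ⟨z, hz, hz'⟩ := exists_hasDerivAt_eq_zero hxy
        (fun t ht => (hder t ht).continuousAt.continuousWithinAt)
        (by simp [(hP₁ x hx).2.1, (hP₁ y hy).2.1]) fun t ht => hder t (Ioo_subset_Icc_self ht)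
      refine ⟨z, hz, ?_⟩
      have hne : K z * U z ^ 2 ≠ 0 :=
        mul_ne_zero (hC.K_pos z).ne' (pow_ne_zero 2 (hUne z (Ioo_subset_Icc_self hz)))
      simpa [hne] using (div_eq_zero_iff.1 hz').resolve_right hne)
  have hT₁I : ∀ z ∈ T₁, z ∈ Ioo α β := fun z hz => by
    obtain ⟨-, x, hx, y, hy, hzxy⟩ := hT₁ z hz
    exact ⟨(hP₁ x hx).1.1.trans_lt hzxy.1, hzxy.2.trans_le (hP₁ y hy).1.2⟩
  -- zeros of the Wronskian
  set M := ZY.filter fun x => 2 ≤ vanishingOrder Y x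
  have hM : ∀ x ∈ M, x ∈ ZY ∧ 2 ≤ vanishingOrder Y x := fun x hx => Finset.mem_filter.1 hx
  -- Multiple zeros of `Y` are also zeros of the Wronskian. The two endpoints offset the losses in
  -- both uses of Rolle's theorem.
  set P₂ := M ∪ T₁ ∪ {α, β}
  have hP₂card : P₂.card = M.card + T₁.card + 2 := by
    rw [Finset.card_union_of_disjoint, Finset.card_union_of_disjoint, Finset.card_pair hαβ.ne]
    · refine Finset.disjoint_left.2 fun x hx hx' => Finset.disjoint_left.1 hT₁d hx' ?_
      simp only [P₁, Finset.mem_union]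
      exact Or.inl (Or.inl (hM x hx).1)
    · refine Finset.disjoint_left.2 fun x hx hx' => ?_
      have hxI : x ∈ Ioo α β := by
        rcases Finset.mem_union.1 hx with hx | hx
        · exact (hZY x (hM x hx).1).1
        · exact hT₁I x hx
      rcases Finset.mem_insert.1 hx' with rfl | hx'
      · exact lt_irrefl _ hxI.1
      · rw [Finset.mem_singleton.1 hx'] at hxI
        exact lt_irrefl _ hxI.2
  have hP₂ : ∀ x ∈ P₂, x ∈ Icc α β ∧ wronskian K Y U x = 0 := by
    intro x hx
    simp only [P₂, Finset.mem_union, Finset.mem_insert, Finset.mem_singleton] at hx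
    rcases hx with (hx | hx) | rfl | rfl
    · refine ⟨Ioo_subset_Icc_self (hZY x (hM x hx).1).1, ?_⟩
      have h1 := (vanishesTo_vanishingOrder Y x).mono (hM x hx).2
      rw [vanishesTo_succ, vanishesTo_one] at h1
      rw [wronskian, h1.1, h1.2]
      ring
    · exact ⟨Ioo_subset_Icc_self (hT₁I x hx), (hT₁ x hx).1⟩
    · exact ⟨hα', hYZ.wronskian_left hU⟩
    · exact ⟨hβ', hYZ.wronskian_right hU⟩
  obtain ⟨T₂, hT₂d, hT₂c, hT₂⟩ := exists_finset_between (Q := fun z => κ * G z * U z * Z z = 0) P₂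
    (fun x hx y hy hxy => by
      have hder := fun t (ht : t ∈ Icc x y) => hYZ.hasDerivAt_wronskian hC hU
        (x := t) ⟨(hP₂ x hx).1.1.trans ht.1, ht.2.trans (hP₂ y hy).1.2⟩
      obtain ⟨z, hz, hz'⟩ := exists_hasDerivAt_eq_zero hxy
        (fun t ht => (hder t ht).continuousAt.continuousWithinAt)
        (by rw [(hP₂ x hx).2, (hP₂ y hy).2]) fun t ht => hder t (Ioo_subset_Icc_self ht)
      exact ⟨z, hz, neg_eq_zero.1 hz'⟩)
  have hT₂Z : T₂ ⊆ ZZ := fun z hz => by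
    obtain ⟨hz0, x, hx, y, hy, hzxy⟩ := hT₂ z hz
    have hzI : z ∈ Ioo α β :=
      ⟨(hP₂ x hx).1.1.trans_lt hzxy.1, hzxy.2.trans_le (hP₂ y hy).1.2⟩
    have hne : κ * G z * U z ≠ 0 :=
      mul_ne_zero (mul_ne_zero hκ (hC.G_pos z).ne') (hUpos z hzI).ne'
    exact hZf.mem_toFinset.2 ⟨hzI, (mul_eq_zero.1 hz0).resolve_left hne⟩
  have hT₂M : Disjoint T₂ M := Finset.disjoint_left.2 fun x hx hx' =>
    Finset.disjoint_left.1 hT₂d hx (by simp only [P₂, Finset.mem_union]; exact Or.inl (Or.inl hx'))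
  -- the two sums
  have hsumY : ∑ x ∈ ZY, vanishingOrder Y x =
      ZY.card + (M.card + ∑ x ∈ M, (vanishingOrder Y x - 2)) := by
    -- An order `k ≥ 2` splits as `1 + 1 + (k - 2)`: the zero itself, its membership in `M`, and the
    -- part that `Z` inherits.
    have h1 : ∀ x ∈ ZY, vanishingOrder Y x =
        1 + if 2 ≤ vanishingOrder Y x then 1 + (vanishingOrder Y x - 2) else 0 := fun x hx => by
      have := one_le_vanishingOrder (hY x (Ioo_subset_Icc_self (hZY x hx).1)) (hZY x hx).2
      split_ifs <;> omega
    rw [Finset.sum_congr rfl h1, Finset.sum_add_distrib, ← Finset.sum_filter,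
      Finset.sum_add_distrib]
    simp [M]
  have hsumZ : T₂.card + ∑ x ∈ M, (vanishingOrder Y x - 2) ≤ ∑ x ∈ ZZ, vanishingOrder Z x := by
    have h1 : ∑ x ∈ ZZ, vanishingOrder Z x = ∑ x ∈ ZZ ∪ M, vanishingOrder Z x := by
      refine Finset.sum_subset Finset.subset_union_left fun x hx hx' => vanishingOrder_eq_zero ?_
      intro h0
      have hxM := (Finset.mem_union.1 hx).resolve_left hx'
      exact hx' (hZf.mem_toFinset.2 ⟨(hZY x (hM x hxM).1).1, h0⟩)
    rw [h1]
    refine le_trans ?_ (Finset.sum_le_sum_of_subset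
      (Finset.union_subset_union_left (t := M) hT₂Z))
    rw [Finset.sum_union hT₂M, Finset.card_eq_sum_ones]
    refine add_le_add (Finset.sum_le_sum fun x hx => ?_) (Finset.sum_le_sum fun x hx => ?_)
    · obtain ⟨hxI, hx0⟩ := hZf.mem_toFinset.1 (hT₂Z hx)
      exact one_le_vanishingOrder (hZ x (Ioo_subset_Icc_self hxI)) hx0
    · have hxI := Ioo_subset_Icc_self (hZY x (hM x hx).1).1
      exact (hYZ.vanishesTo hC hκ hxI (vanishesTo_vanishingOrder Y x)).le_vanishingOrder (hZ x hxI)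
  -- The cardinalities chain to `M.card + P₁.card ≤ T₂.card`.
  omega

/-- The shifted operator does not decrease the number of zeros counted with multiplicities. -/
theorem IsShift.NmBar_le (hC : SmoothCoeffs K G L) (hαβ : α < β) (hκ : κ ≠ 0)
    (hYZ : IsShift α β K G L h H r₀ κ Y Z) (hU : IsMode α β K G L h H r₀ U)
    (hUpos : ∀ x ∈ Ioo α β, 0 < U x)
    (hY : ∀ x ∈ Icc α β, ∃ p, iteratedDeriv p Y x ≠ 0)
    (hZ : ∀ x ∈ Icc α β, ∃ p, iteratedDeriv p Z x ≠ 0) :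
    NmBar α β h H Y ≤ NmBar α β h H Z := by
  have hYf := interiorZeros_finite hYZ.contDiff_left hY
  have hZf := interiorZeros_finite hYZ.contDiff_right hZ
  have h1 := hYZ.sum_order_le hC hαβ hκ hU hUpos hY hZ hYf hZf
  have h2 := hYZ.reducedMultiplicity_le hC hαβ hκ hZ (left_mem_Icc.2 hαβ.le) h
  have h3 := hYZ.reducedMultiplicity_le hC hαβ hκ hZ (right_mem_Icc.2 hαβ.le) H
  rw [NmBar, NmBar, Nm_eq_sum hαβ hYZ.contDiff_left hYf, Nm_eq_sum hαβ hYZ.contDiff_right hZf]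
  have h4 : ((∑ x ∈ hYf.toFinset, vanishingOrder Y x : ℕ) : ℚ) + (robinZero h Y α).card +
      (robinZero H Y β).card ≤ ((∑ x ∈ hZf.toFinset, vanishingOrder Z x : ℕ) : ℚ) := by
    exact_mod_cast h1
  linarith

/-- A function with alternating signs has many zeros of odd order. -/
theorem Alternates.le_Nv (hαβ : α < β) {f : ℝ → ℝ} (hf : ContDiff ℝ ∞ f)
    (hfin : ∀ x ∈ Icc α β, ∃ p, iteratedDeriv p f x ≠ 0) {j : ℕ} (hj : Alternates α β f j) :
    (j : ℚ) ≤ Nv α β f := by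
  obtain ⟨t, ε, ht, hlt, hsign⟩ := hj
  have hF := interiorZeros_finite hf hfin
  have h1 : ∀ i < j, ∃ z ∈ Ioo (t i) (t (i + 1)), f z = 0 ∧ Odd (vanishingOrder f z) := by
    intro i hi
    refine exists_odd_order_of_sign_change (ε := ε * (-1) ^ i) (hlt i hi) hf
      (fun x hx => hfin x ⟨((ht i hi.le).1.trans hx.1).le, (hx.2.trans (ht (i + 1) hi).2).le⟩)
      (hsign i hi.le) ?_
    have := hsign (i + 1) hi
    rw [pow_succ] at this
    linarith
  choose! z hz hz0 hzodd using h1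
  have hzI : ∀ i < j, z i ∈ Ioo α β := fun i hi =>
    ⟨(ht i hi.le).1.trans (hz i hi).1, (hz i hi).2.trans (ht (i + 1) hi).2⟩
  have hmono : ∀ a b, a < b → b < j → z a < z b := by
    intro a b hab hbj
    induction b with
    | zero => omega
    | succ b ih =>
      have h2 := (hz b (by omega)).2.trans (hz (b + 1) hbj).1
      rcases (Nat.lt_succ_iff.1 hab).eq_or_lt with rfl | hlt'
      · exact h2
      · exact (ih hlt' (by omega)).trans h2
  have hinj : Set.InjOn z (Finset.range j : Set ℕ) := by
    intro a ha b hb hab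
    simp only [Finset.coe_range, mem_Iio] at ha hb
    by_contra hne
    rcases lt_or_gt_of_ne hne with h2 | h2
    · exact (hmono a b h2 hb).ne hab
    · exact (hmono b a h2 ha).ne' hab
  rw [Nv, finsum_mem_eq_finite_toFinset_sum _ hF]
  have hnn : ∀ x ∈ hF.toFinset,
      (0 : ℚ) ≤ 1 / 2 * (1 - (-1) ^ zeroMultiplicity α β f x) := fun x _ => by
    rcases neg_one_pow_eq_or ℚ (zeroMultiplicity α β f x) with h2 | h2 <;> rw [h2] <;> norm_num
  have hsub : (Finset.range j).image z ⊆ hF.toFinset := by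
    intro x hx
    obtain ⟨i, hi, rfl⟩ := Finset.mem_image.1 hx
    have hi' := Finset.mem_range.1 hi
    exact hF.mem_toFinset.2 ⟨hzI i hi', hz0 i hi'⟩
  refine le_trans ?_ (Finset.sum_le_sum_of_subset_of_nonneg hsub fun x hx _ => hnn x hx)
  rw [Finset.sum_image hinj]
  have h3 : ∀ i ∈ Finset.range j,
      (1 / 2 : ℚ) * (1 - (-1) ^ zeroMultiplicity α β f (z i)) = 1 := fun i hi => by
    have hi' := Finset.mem_range.1 hi
    rw [zeroMultiplicity_eq hαβ hf (fun _ _ => rfl) (Ioo_subset_Icc_self (hzI i hi')),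
      (hzodd i hi').neg_one_pow]
    norm_num
  rw [Finset.sum_congr rfl h3]
  simp

end

/-! ### Passage to the limit -/

section

variable {α β : ℝ} {K G L : ℝ → ℝ} {h H : ENNReal} {s : Finset ℕ} {V : ℕ → ℝ → ℝ} {ρ : ℕ → ℝ}

/-- A function which satisfies the boundary conditions and is `C¹`-close to a mode `W` has at most
as many zeros as `W`. -/
theorem IsMode.exists_NmBar_le (hC : SmoothCoeffs K G L) (hαβ : α < β) {r : ℝ} {W : ℝ → ℝ}
    (hW : IsMode α β K G L h H r W) (hWf : (interiorZeros α β W).Finite) :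
    ∃ δ > 0, ∀ Y : ℝ → ℝ, ContDiff ℝ ∞ Y →
      Y α * Real.cos (leftAngle h) = K α * deriv Y α * Real.sin (leftAngle h) →
      Y β * Real.cos (rightAngle H) = K β * deriv Y β * Real.sin (rightAngle H) →
      (∀ x ∈ Icc α β, |Y x - W x| < δ ∧ |deriv Y x - deriv W x| < δ) →
      (interiorZeros α β Y).Finite → NmBar α β h H Y ≤ ((interiorZeros α β W).ncard : ℚ) := by
  have hα' : α ∈ Icc α β := left_mem_Icc.2 hαβ.le
  have hβ' : β ∈ Icc α β := right_mem_Icc.2 hαβ.le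
  have hWc := hW.contDiff.continuous
  have hW'c := (contDiff_deriv hW.contDiff).continuous
  -- `W` and `W'` have no common zero; in particular `|W'| ≥ c` at the zeros of `W`.
  obtain ⟨c, hc, hcW⟩ := (isCompact_Icc (a := α) (b := β)).exists_forall_le' (a := (0 : ℝ))
    (f := fun x => |W x| + |deriv W x|) (hWc.abs.add hW'c.abs).continuousOn fun x hx => by
      rcases hW.ne_zero x hx with h1 | h1
      · exact add_pos_of_pos_of_nonneg (abs_pos.2 h1) (abs_nonneg _)
      · exact add_pos_of_nonneg_of_pos (abs_nonneg _) (abs_pos.2 h1)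
  obtain ⟨ε, hε, hεW⟩ := Metric.uniformContinuousOn_iff.1
    (isCompact_Icc.uniformContinuousOn_of_continuous (hW'c.continuousOn (s := Icc α β)))
    (c / 2) (half_pos hc)
  -- Within `ε` of a zero of `W` the derivative of `Y` will be nonzero; on the rest of `[α, β]`,
  -- `|W| ≥ η` keeps `Y` from vanishing.
  obtain ⟨O, hOdef⟩ : ∃ O : Set ℝ, O = ⋃ z ∈ {z ∈ Icc α β | W z = 0}, Metric.ball z ε := ⟨_, rfl⟩
  have hO : IsOpen O := by
    rw [hOdef]; exact isOpen_biUnion fun z _ => Metric.isOpen_ball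
  obtain ⟨η, hη, hηW⟩ := ((isCompact_Icc (a := α) (b := β)).diff hO).exists_forall_le'
    (a := (0 : ℝ)) (f := fun x => |W x|) hWc.abs.continuousOn fun x hx => by
      refine abs_pos.2 fun h0 => hx.2 ?_
      rw [hOdef]
      exact mem_biUnion (show x ∈ {z ∈ Icc α β | W z = 0} from ⟨hx.1, h0⟩) (Metric.mem_ball_self hε)
  refine ⟨min η (c / 2), lt_min hη (half_pos hc), fun Y hY hYl hYr hclose hYf => ?_⟩
  have hYd := hY.differentiable (by simp)
  -- near a zero of `W`, the derivative of `Y` does not vanish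
  have hder : ∀ z ∈ Icc α β, W z = 0 → ∀ x ∈ Icc α β, dist x z < ε → deriv Y x ≠ 0 := by
    intro z hz hz0 x hx hxz h0
    have h1 := hεW x hx z hz hxz
    have h2 := hcW z hz
    have h3 := ((hclose x hx).2).trans_le (min_le_right _ _)
    rw [h0, zero_sub, abs_neg] at h3
    simp only [hz0, abs_zero, zero_add] at h2
    rw [Real.dist_eq, abs_sub_comm] at h1
    have h4 := abs_sub_abs_le_abs_sub (deriv W z) (deriv W x)
    linarith
  have hrolle : ∀ z ∈ Icc α β, W z = 0 → ∀ x ∈ Icc α β, ∀ y ∈ Icc α β, dist x z < ε →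
      dist y z < ε → Y x = 0 → Y y = 0 → ¬ x < y := by
    intro z hz hz0 x hx y hy hxz hyz hx0 hy0 hxy
    obtain ⟨t, ht, ht'⟩ := exists_deriv_eq_zero hxy hYd.continuous.continuousOn (by rw [hx0, hy0])
    refine hder z hz hz0 t ⟨hx.1.trans ht.1.le, ht.2.le.trans hy.2⟩ ?_ ht'
    rw [Real.dist_eq, abs_lt] at *
    exact ⟨by linarith [hxz.1, ht.1], by linarith [hyz.2, ht.2]⟩
  have hnear : ∀ x ∈ Icc α β, Y x = 0 → ∃ z ∈ Icc α β, W z = 0 ∧ dist x z < ε := by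
    intro x hx hx0
    have h1 := ((hclose x hx).1).trans_le (min_le_left _ _)
    rw [hx0, zero_sub, abs_neg] at h1
    have h2 : x ∈ O := by
      by_contra hxO
      exact absurd (hηW x ⟨hx, hxO⟩) (not_le.2 h1)
    rw [hOdef, mem_iUnion₂] at h2
    obtain ⟨z, hz, hxz⟩ := h2
    exact ⟨z, hz.1, hz.2, hxz⟩
  -- So the zeros of `Y` are simple, none lies at a Robin endpoint, and `NmBar` is a plain count.
  have hnd : ∀ x ∈ Icc α β, Y x = 0 → deriv Y x ≠ 0 := fun x hx hx0 => by
    obtain ⟨z, hz, hz0, hxz⟩ := hnear x hx hx0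
    exact hder z hz hz0 x hx hxz
  have hredα : reducedMultiplicity α β h Y α = 0 := by
    unfold reducedMultiplicity
    split_ifs with hh
    · rfl
    · rw [zeroMultiplicity_eq hαβ hY (fun _ _ => rfl) hα', vanishingOrder_eq_zero]
      · simp
      · intro h0
        exact hnd α hα' h0 (deriv_eq_zero_of_angle hYl (hC.K_pos _) (sin_leftAngle_pos hh) h0)
  have hredβ : reducedMultiplicity α β H Y β = 0 := by
    unfold reducedMultiplicity
    split_ifs with hh
    · rfl
    · rw [zeroMultiplicity_eq hαβ hY (fun _ _ => rfl) hβ', vanishingOrder_eq_zero]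
      · simp
      · intro h0
        exact hnd β hβ' h0 (deriv_eq_zero_of_angle hYr (hC.K_pos _) (sin_rightAngle_pos hh) h0)
  have hNm : Nm α β Y = ((interiorZeros α β Y).ncard : ℚ) := by
    rw [Nm_eq_sum hαβ hY hYf, ncard_eq_toFinset_card _ hYf, Finset.card_eq_sum_ones]
    norm_cast
    refine Finset.sum_congr rfl fun x hx => ?_
    obtain ⟨hxI, hx0⟩ := hYf.mem_toFinset.1 hx
    exact vanishingOrder_eq_one hx0 (hnd x (Ioo_subset_Icc_self hxI) hx0)
  rw [NmBar, hredα, hredβ, add_zero, add_zero, hNm, Nat.cast_le]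
  -- Each zero of `Y` is sent to a nearby zero of `W`; by Rolle's theorem no two share an image.
  choose! z hz hz0 hxz using hnear
  refine ncard_le_ncard_of_injOn z (fun x hx => ?_) (fun x hx y hy hxy => ?_) hWf
  · have hxI := Ioo_subset_Icc_self hx.1
    have hzI := hz x hxI hx.2
    refine ⟨⟨hzI.1.lt_of_ne fun heq => ?_, hzI.2.lt_of_ne fun heq => ?_⟩, hz0 x hxI hx.2⟩
    · have hW0 := hz0 x hxI hx.2
      have hxz' := hxz x hxI hx.2
      rw [← heq] at hW0 hxz'
      -- `W` vanishes at `α` only under a Dirichlet condition. Then `Y α = 0` as well, and Rolle's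
      -- theorem on `[α, x]` gives a contradiction.
      have htop : h = ⊤ := by
        by_contra hh
        exact (hW.ne_zero α hα').elim (· hW0)
          (· (deriv_eq_zero_of_angle hW.left (hC.K_pos _) (sin_leftAngle_pos hh) hW0))
      have hYα : Y α = 0 := by simpa [leftAngle, htop] using hYl
      exact hrolle α hα' hW0 α hα' x hxI (by simpa using hε) hxz' hYα hx.2 hx.1.1
    · have hW0 := hz0 x hxI hx.2
      have hxz' := hxz x hxI hx.2
      rw [heq] at hW0 hxz'
      have htop : H = ⊤ := by
        by_contra hh
        exact (hW.ne_zero β hβ').elim (· hW0)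
          (· (deriv_eq_zero_of_angle hW.right (hC.K_pos _) (sin_rightAngle_pos hh) hW0))
      have hYβ : Y β = 0 := by simpa [rightAngle, htop] using hYr
      exact hrolle β hβ' hW0 x hxI β hβ' hxz' (by simpa using hε) hx.2 hYβ hx.1.2
  · have hxI := Ioo_subset_Icc_self hx.1
    have hyI := Ioo_subset_Icc_self hy.1
    have h1 := hxz x hxI hx.2
    have h2 := hxz y hyI hy.2
    rw [← hxy] at h2
    exact le_antisymm
      (not_lt.1 (hrolle _ (hz x hxI hx.2) (hz0 x hxI hx.2) y hyI x hxI h2 h1 hy.2 hx.2))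
      (not_lt.1 (hrolle _ (hz x hxI hx.2) (hz0 x hxI hx.2) x hxI y hyI h1 h2 hx.2 hy.2))

theorem eventually_comb_close (hV : ∀ p ∈ s, Continuous (V p)) {B : ℕ → ℕ → ℝ} {B' : ℕ → ℝ}
    (hB : ∀ p ∈ s, Tendsto (fun k => B k p) atTop (𝓝 (B' p))) {δ : ℝ} (hδ : 0 < δ) :
    ∀ᶠ k in atTop, ∀ x ∈ Icc α β, |comb s V (B k) x - comb s V B' x| < δ := by
  have hbd : ∀ p ∈ s, ∃ C, ∀ x ∈ Icc α β, |V p x| ≤ C := fun p hp =>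
    isCompact_Icc.exists_bound_of_continuousOn (hV p hp).continuousOn
  choose! C hCV using hbd
  have h1 : Tendsto (fun k => ∑ p ∈ s, |B k p - B' p| * C p) atTop (𝓝 0) := by
    have : Tendsto (fun k => ∑ p ∈ s, |B k p - B' p| * C p) atTop (𝓝 (∑ p ∈ s, 0)) := by
      refine tendsto_finsetSum _ fun p hp => ?_
      have := ((hB p hp).sub_const (B' p)).abs.mul_const (C p)
      simpa using this
    simpa using this
  filter_upwards [h1.eventually_lt_const hδ] with k hk x hx
  refine lt_of_le_of_lt ?_ hk
  rw [comb, comb, ← Finset.sum_sub_distrib]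
  refine (Finset.abs_sum_le_sum_abs _ _).trans (Finset.sum_le_sum fun p hp => ?_)
  rw [← sub_mul, abs_mul]
  exact mul_le_mul_of_nonneg_left (hCV p hp x hx) (abs_nonneg _)

theorem Alternates.eventually {f : ℕ → ℝ → ℝ} {g : ℝ → ℝ} {j : ℕ} (hg : Alternates α β g j)
    (hf : ∀ x ∈ Icc α β, Tendsto (fun k => f k x) atTop (𝓝 (g x))) :
    ∀ᶠ k in atTop, Alternates α β (f k) j := by
  obtain ⟨t, ε, ht, hlt, hsign⟩ := hg
  have h1 : ∀ᶠ k in atTop, ∀ i ∈ Finset.range (j + 1), 0 < ε * (-1) ^ i * f k (t i) := by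
    refine (Filter.eventually_all_finset _).2 fun i hi => ?_
    have hi' : i ≤ j := Nat.lt_succ_iff.1 (Finset.mem_range.1 hi)
    exact ((hf _ (Ioo_subset_Icc_self (ht i hi'))).const_mul (ε * (-1) ^ i)).eventually_const_lt
      (hsign i hi')
  filter_upwards [h1] with k hk
  exact ⟨t, ε, ht, hlt, fun i hi => hk i (Finset.mem_range.2 (Nat.lt_succ_iff.2 hi))⟩

theorem comb_ite_eq {N : ℕ} (hN : N ∈ s) (A : ℕ → ℝ) :
    comb s V (fun p => if p = N then A p else 0) = fun x => A N * V N x := by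
  ext x
  rw [comb, Finset.sum_eq_single_of_mem N hN fun p _ hp => by rw [if_neg hp, zero_mul], if_pos rfl]

theorem Alternates.mono {f : ℝ → ℝ} {i j : ℕ} (hf : Alternates α β f j) (hij : i ≤ j) :
    Alternates α β f i := by
  obtain ⟨t, ε, h1, h2, h3⟩ := hf
  exact ⟨t, ε, fun k hk => h1 k (hk.trans hij), fun k hk => h2 k (hk.trans_le hij),
    fun k hk => h3 k (hk.trans hij)⟩

/-- The upper bound for combinations of modes whose last term is `A N * V N`. -/
theorem NmBar_comb_le (hC : SmoothCoeffs K G L) (hαβ : α < β)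
    (hV : ∀ p ∈ s, IsMode α β K G L h H (ρ p) (V p)) (hρ : Set.InjOn ρ s) {r₀ : ℝ} {U : ℝ → ℝ}
    (hU : IsMode α β K G L h H r₀ U) (hUpos : ∀ x ∈ Ioo α β, 0 < U x)
    (hr₀ : ∀ p ∈ s, r₀ ≤ ρ p) {A : ℕ → ℝ} {N : ℕ} (hN : N ∈ s) (hAN : A N ≠ 0)
    (hlt : ∀ p ∈ s, p ≠ N → ρ p < ρ N) (hVf : (interiorZeros α β (V N)).Finite) :
    NmBar α β h H (comb s V A) ≤ ((interiorZeros α β (V N)).ncard : ℚ) := by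
  have hVs : ∀ p ∈ s, ContDiff ℝ ∞ (V p) := fun p hp => (hV p hp).contDiff
  have hzero : interiorZeros α β (fun x => A N * V N x) = interiorZeros α β (V N) := by
    ext x
    simp [interiorZeros, hAN]
  have hWmode := (hV N hN).const_mul hAN
  obtain ⟨δ, hδ, hclose⟩ := hWmode.exists_NmBar_le hC hαβ (by rwa [hzero])
  rw [hzero] at hclose
  rcases (hr₀ N hN).eq_or_lt with heq | hpos
  · -- only the ground state occurs
    have hs : s = {N} := by
      refine Finset.eq_singleton_iff_unique_mem.2 ⟨hN, fun p hp => ?_⟩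
      by_contra hne
      exact absurd (hlt p hp hne) (not_lt.2 (heq ▸ hr₀ p hp))
    have hcomb : comb s V A = fun x => A N * V N x := by
      ext x; simp [comb, hs]
    rw [hcomb]
    exact hclose _ hWmode.contDiff hWmode.left hWmode.right (fun x _ => by simpa using hδ)
      (by rwa [hzero])
  · have hκ : 0 < ρ N - r₀ := sub_pos.2 hpos
    -- Iterates of `T - r₀` divided by its eigenvalue on the top mode: that coefficient is fixed,
    -- the others decay.
    obtain ⟨B, hBdef⟩ : ∃ B : ℕ → ℕ → ℝ, B = fun k p => ((ρ p - r₀) / (ρ N - r₀)) ^ k * A p :=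
      ⟨_, rfl⟩
    have hBN : ∀ k, B k N = A N := fun k => by simp [hBdef, div_self hκ.ne']
    have hshift : ∀ k, IsShift α β K G L h H r₀ (ρ N - r₀) (comb s V (B k))
        (comb s V (B (k + 1))) := fun k => isShift_comb hC hV fun p _ => by
      simp only [hBdef]
      rw [pow_succ]
      field_simp
    have hfin : ∀ k, ∀ x ∈ Icc α β, ∃ q, iteratedDeriv q (comb s V (B k)) x ≠ 0 := fun k =>
      exists_iteratedDeriv_comb_ne_zero hC hV hρ ⟨N, hN, by rw [hBN]; exact hAN⟩
    have hmono : ∀ k, NmBar α β h H (comb s V (B 0)) ≤ NmBar α β h H (comb s V (B k)) := by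
      intro k
      induction k with
      | zero => exact le_rfl
      | succ k ih =>
        exact ih.trans ((hshift k).NmBar_le hC hαβ hκ.ne' hU hUpos (hfin k) (hfin (k + 1)))
    have hlim : ∀ p ∈ s, Tendsto (fun k => B k p) atTop (𝓝 (if p = N then A p else 0)) := by
      intro p hp
      split_ifs with hpN
      · subst hpN
        simp only [hBN]
        exact tendsto_const_nhds
      · simp only [hBdef]
        have h1 := (tendsto_pow_atTop_nhds_zero_of_lt_one
          (div_nonneg (sub_nonneg.2 (hr₀ p hp)) hκ.le)
          ((div_lt_one hκ).2 (sub_lt_sub_right (hlt p hp hpN) r₀))).mul_const (A p)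
        simpa using h1
    have h1 := eventually_comb_close (α := α) (β := β) (fun p hp => (hVs p hp).continuous) hlim hδ
    have h2 := eventually_comb_close (α := α) (β := β)
      (fun p hp => (contDiff_deriv (hVs p hp)).continuous) hlim hδ
    obtain ⟨k, hk1, hk2⟩ := (h1.and h2).exists
    have hB0 : B 0 = A := by ext p; simp [hBdef]
    rw [← hB0]
    refine (hmono k).trans (hclose _ (hshift k).contDiff_left (hshift k).left (hshift k).right
      (fun x hx => ⟨?_, ?_⟩) (interiorZeros_finite (hshift k).contDiff_left (hfin k)))
    · simpa only [comb_ite_eq hN] using hk1 x hx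
    · have := hk2 x hx
      rw [← deriv_comb hVs, ← deriv_comb hVs, comb_ite_eq hN] at this
      exact this

/-- The lower bound for combinations of modes whose first term is `A M * V M`. -/
theorem alternates_comb (hC : SmoothCoeffs K G L) (hαβ : α < β)
    (hV : ∀ p ∈ s, IsMode α β K G L h H (ρ p) (V p)) {r₀ : ℝ} {U : ℝ → ℝ}
    (hU : IsMode α β K G L h H r₀ U) (hUpos : ∀ x ∈ Ioo α β, 0 < U x)
    (hr₀ : ∀ p ∈ s, r₀ < ρ p) {A : ℕ → ℝ} {M : ℕ} (hM : M ∈ s) (hAM : A M ≠ 0)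
    (hlt : ∀ p ∈ s, p ≠ M → ρ M < ρ p) {j : ℕ} (hj : 1 ≤ j) (hVj : Alternates α β (V M) j) :
    Alternates α β (comb s V A) j := by
  have hκ : 0 < ρ M - r₀ := sub_pos.2 (hr₀ M hM)
  -- Iterates of the inverse, available because `r₀ < ρ p`: the lowest mode survives.
  obtain ⟨B, hBdef⟩ : ∃ B : ℕ → ℕ → ℝ, B = fun k p => ((ρ M - r₀) / (ρ p - r₀)) ^ k * A p :=
    ⟨_, rfl⟩
  have hshift : ∀ k, IsShift α β K G L h H r₀ (ρ M - r₀) (comb s V (B (k + 1)))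
      (comb s V (B k)) := fun k => isShift_comb hC hV fun p hp => by
    have := (sub_pos.2 (hr₀ p hp)).ne'
    simp only [hBdef]
    rw [pow_succ]
    field_simp
  have hlim : ∀ p ∈ s, Tendsto (fun k => B k p) atTop (𝓝 (if p = M then A p else 0)) := by
    intro p hp
    split_ifs with hpM
    · subst hpM
      simp [hBdef, div_self hκ.ne']
    · have hp' := sub_pos.2 (hr₀ p hp)
      simp only [hBdef]
      have h1 := (tendsto_pow_atTop_nhds_zero_of_lt_one (div_nonneg hκ.le hp'.le)
        ((div_lt_one hp').2 (sub_lt_sub_right (hlt p hp hpM) r₀))).mul_const (A p)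
      simpa using h1
  have hev := (hVj.const_mul hAM).eventually (f := fun k => comb s V (B k)) fun x _ => by
    rw [← congrFun (comb_ite_eq (V := V) hM A) x]
    exact tendsto_finsetSum _ fun p hp => (hlim p hp).mul_const (V p x)
  obtain ⟨k, hk⟩ := hev.exists
  have hdown : ∀ k, Alternates α β (comb s V (B k)) j → Alternates α β (comb s V (B 0)) j := by
    intro k
    induction k with
    | zero => exact id
    | succ k ih => exact fun hk => ih ((hshift k).alternates hC hαβ hκ hU hUpos hj hk)
  have hB0 : B 0 = A := by ext p; simp [hBdef]
  rw [← hB0]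
  exact hdown k hk

end

end SturmLiouville

/-! ### The bounds for an arbitrary combination -/

open SturmLiouville in
/-- The first three conjuncts say that the counting functions are well defined for the
linear combination; then come the chain of inequalities, the two bounds, and the resulting
bounds for the number of distinct interior zeros. -/
theorem theorem2p12 (α₀ α β β₀ : ℝ) (K G L : ℝ → ℝ) (h H : ENNReal)
    (hadm : SturmLiouville.Admissible α₀ α β β₀ K G L)
    (m n : ℕ) (hm : 1 ≤ m) (hmn : m ≤ n)
    (V : ℕ → ℝ → ℝ)
    (hV : ∀ p ∈ Finset.Icc m n, SturmLiouville.IsNthEigenfunction α β K G L h H p (V p))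
    (A : ℕ → ℝ) (hA : ∑ p ∈ Finset.Icc m n, A p ^ 2 ≠ 0)
    (Y : ℝ → ℝ) (hY : Y = fun x => ∑ p ∈ Finset.Icc m n, A p * V p x) :
    ContDiffOn ℝ ∞ Y (Set.Icc α β) ∧
    (SturmLiouville.interiorZeros α β Y).Finite ∧
    (∀ ξ ∈ Set.Icc α β, SturmLiouville.FiniteOrderAt α β Y ξ) ∧
    SturmLiouville.Nv α β Y ≤ SturmLiouville.Nm α β Y ∧
    SturmLiouville.Nm α β Y ≤ SturmLiouville.NmBar α β h H Y ∧
    (m : ℚ) - 1 ≤ SturmLiouville.Nv α β Y ∧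
    SturmLiouville.NmBar α β h H Y ≤ (n : ℚ) - 1 ∧
    (m : ℚ) - 1 ≤ ((SturmLiouville.interiorZeros α β Y).ncard : ℚ) ∧
    ((SturmLiouville.interiorZeros α β Y).ncard : ℚ) ≤ (n : ℚ) - 1 := by
  have hαβ : α < β := hadm.2.1
  obtain ⟨K', G', L', hC, hK, hG, hL⟩ := hadm.exists_smoothCoeffs
  have hmodes := fun p hp => exists_mode_of_isNthEigenfunction hC hαβ
    ((hV p hp).congr_coeffs hαβ hK hG hL)
  choose! ρ W hnth hmode hVW hWf hWcard hWalt using hmodes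
  obtain ⟨r₀, U, hU, hUpos, hr₀⟩ := exists_ground_state hC hαβ
    (hnth m (Finset.mem_Icc.2 ⟨le_rfl, hmn⟩))
  -- the indices which occur
  obtain ⟨s, hs⟩ : ∃ s : Finset ℕ, s = (Finset.Icc m n).filter fun p => A p ≠ 0 := ⟨_, rfl⟩
  have hsI : ∀ p ∈ s, p ∈ Finset.Icc m n ∧ A p ≠ 0 := fun p hp => by
    rw [hs] at hp; exact Finset.mem_filter.1 hp
  have hsne : s.Nonempty := by
    by_contra hempty
    refine hA (Finset.sum_eq_zero fun p hp => ?_)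
    by_contra hne
    exact hempty ⟨p, by rw [hs]; exact Finset.mem_filter.2 ⟨hp, fun h0 => hne (by simp [h0])⟩⟩
  have hYW : EqOn Y (comb s W A) (Icc α β) := fun x hx => by
    rw [hY, comb, hs, Finset.sum_filter]
    refine Finset.sum_congr rfl fun p hp => ?_
    rw [hVW p hp hx]
    split_ifs with h0
    · rfl
    · rw [not_not.1 h0, zero_mul]
  have hsmode : ∀ p ∈ s, IsMode α β K' G' L' h H (ρ p) (W p) := fun p hp => hmode p (hsI p hp).1
  have hρlt : ∀ p ∈ s, ∀ q ∈ s, p < q → ρ p < ρ q := fun p hp q hq hpq =>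
    (hnth p (hsI p hp).1).lt_of_lt (hnth q (hsI q hq).1) hpq
  have hρ : Set.InjOn ρ s := fun p hp q hq hpq => by
    by_contra hne
    rcases lt_or_gt_of_ne hne with h1 | h1
    · exact (hρlt p hp q hq h1).ne hpq
    · exact (hρlt q hq p hp h1).ne' hpq
  have hsmooth : ContDiff ℝ ∞ (comb s W A) := contDiff_comb (fun p hp => (hsmode p hp).contDiff) A
  have hfin : ∀ x ∈ Icc α β, ∃ q, iteratedDeriv q (comb s W A) x ≠ 0 := by
    obtain ⟨p, hp⟩ := hsne
    exact exists_iteratedDeriv_comb_ne_zero hC hsmode hρ ⟨p, hp, (hsI p hp).2⟩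
  have hzeros : interiorZeros α β Y = interiorZeros α β (comb s W A) := by
    ext x
    refine and_congr_right fun hx => ?_
    rw [hYW (Ioo_subset_Icc_self hx)]
  have hfinite := interiorZeros_finite hsmooth hfin
  have hord : ∀ x ∈ interiorZeros α β (comb s W A),
      1 ≤ zeroMultiplicity α β (comb s W A) x := fun x hx => by
    have hxI := Ioo_subset_Icc_self hx.1
    rw [zeroMultiplicity_eq hαβ hsmooth (fun _ _ => rfl) hxI]
    exact one_le_vanishingOrder (hfin x hxI) hx.2
  have hNvcard : Nv α β (comb s W A) ≤ ((interiorZeros α β (comb s W A)).ncard : ℚ) := by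
    rw [Nv, finsum_mem_eq_finite_toFinset_sum _ hfinite, ncard_eq_toFinset_card _ hfinite,
      Finset.card_eq_sum_ones, Nat.cast_sum]
    refine Finset.sum_le_sum fun x _ => ?_
    rcases neg_one_pow_eq_or ℚ (zeroMultiplicity α β (comb s W A) x) with h2 | h2 <;>
      rw [h2] <;> norm_num
  have hcardNm : ((interiorZeros α β (comb s W A)).ncard : ℚ) ≤ Nm α β (comb s W A) := by
    rw [Nm, finsum_mem_eq_finite_toFinset_sum _ hfinite, ncard_eq_toFinset_card _ hfinite,
      Finset.card_eq_sum_ones, Nat.cast_sum]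
    exact Finset.sum_le_sum fun x hx => by exact_mod_cast hord x (hfinite.mem_toFinset.1 hx)
  have hNmBar : Nm α β (comb s W A) ≤ NmBar α β h H (comb s W A) := by
    have hred : ∀ c e, 0 ≤ reducedMultiplicity α β c (comb s W A) e := fun c e => by
      unfold reducedMultiplicity
      split_ifs <;> positivity
    rw [NmBar, add_assoc]
    exact le_add_of_nonneg_right (add_nonneg (hred h α) (hred H β))
  have hupper : NmBar α β h H (comb s W A) ≤ (n : ℚ) - 1 := by
    have hN := s.max'_mem hsne
    set N := s.max' hsne
    have hN' := Finset.mem_Icc.1 (hsI N hN).1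
    refine (NmBar_comb_le hC hαβ hsmode hρ hU hUpos
      (fun p hp => (hr₀ p _ (hnth p (hsI p hp).1)).1) hN (hsI N hN).2
      (fun p hp hne => hρlt p hp N hN (lt_of_le_of_ne (s.le_max' p hp) hne))
      (hWf N (hsI N hN).1)).trans ?_
    have h1 : (interiorZeros α β (W N)).ncard + 1 ≤ n := by
      have : (interiorZeros α β (W N)).ncard ≤ N - 1 := hWcard N (hsI N hN).1
      omega
    have h2 : ((interiorZeros α β (W N)).ncard : ℚ) + 1 ≤ n := by exact_mod_cast h1
    linarith
  have hlower : (m : ℚ) - 1 ≤ Nv α β (comb s W A) := by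
    rcases hm.eq_or_lt with rfl | hm2
    -- For `m = 1` the ground state may occur and the shift need not be invertible, but only
    -- nonnegativity is claimed.
    · rw [Nat.cast_one, sub_self, Nv, finsum_mem_eq_finite_toFinset_sum _ hfinite]
      refine Finset.sum_nonneg fun x _ => ?_
      rcases neg_one_pow_eq_or ℚ (zeroMultiplicity α β (comb s W A) x) with h2 | h2 <;>
        rw [h2] <;> norm_num
    -- For `m ≥ 2` all parameters involved exceed `r₀`, and the lowest mode present has `M - 1 ≥ m -
    -- 1` sign changes.
    · have hM := s.min'_mem hsne
      set M := s.min' hsne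
      have hM' := Finset.mem_Icc.1 (hsI M hM).1
      have halt := (alternates_comb hC hαβ hsmode hU hUpos
        (fun p hp => (hr₀ p _ (hnth p (hsI p hp).1)).2
          (hm2.trans_le (Finset.mem_Icc.1 (hsI p hp).1).1)) hM (hsI M hM).2
        (fun p hp hne => hρlt M hM p hp (lt_of_le_of_ne (s.min'_le p hp) hne.symm))
        (j := M - 1) (by omega) (hWalt M (hsI M hM).1)).mono (i := m - 1) (by omega)
      have h1 := halt.le_Nv hαβ hsmooth hfin
      rwa [Nat.cast_sub hm, Nat.cast_one] at h1
  rw [hzeros, Nv_congr hYW, Nm_congr hYW, NmBar_congr hαβ hYW]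
  refine ⟨hsmooth.contDiffOn.congr hYW, hfinite, fun x hx => ?_, hNvcard.trans hcardNm, hNmBar,
    hlower, hupper, hlower.trans hNvcard, (hcardNm.trans hNmBar).trans hupper⟩
  obtain ⟨q, hq⟩ := hfin x hx
  refine ⟨q, ?_⟩
  rwa [iteratedDerivWithin_congr hYW hx, iteratedDerivWithin_eq_iteratedDeriv
    (uniqueDiffOn_Icc hαβ) (contDiff_infty.1 hsmooth q).contDiffAt hx]
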